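/- Let $\mathcal U,\mathcal Y$ be complex Hilbert spaces, let $\mathbb C^+=\{\mu\in\mathbb C:\operatorname{Re}\mu>0\}$, and let $\varphi:\mathbb C^+\to\mathcal B(\mathcal U,\mathcal Y)$ be a Schur function, i.e. $\varphi$ is holomorphic and its values are contractions. Let $\mathcal H_o$ be the Hilbert space of $\mathcal Y$-valued functions on $\mathbb C^+$ with reproducing kernel $$K_o(\mu,\lambda)=\frac{1_{\mathcal Y}-\varphi(\mu)\varphi(\lambda)^*}{\mu+\overline\lambda},\qquad e_o(\lambda)^*y:=K_o(\cdot,\lambda)y .$$ The observable co-energy-preserving model $S_o=\left[\begin{smallmatrix}A\&B\\ C\&D\end{smallmatrix}\right]_o:\mathcal H_o\oplus\mathcal U\supset\operatorname{dom}(S_o)\to\mathcal H_o\oplus\mathcal Y$ is the adjoint of the closed operator obtained by linearity and limit-closure from $$(e_o(\lambda)^*y,\;y)\mapsto(\overline\lambda\, e_o(\lambda)^*y,\;\varphi(\lambda)^*y),\qquad \lambda\in\mathbb C^+,\ y\in\mathcal Y .$$ Its main operator $A_o$ and observation operator $C_o$ are given on $\operatorname{dom}(A_o)=\operatorname{dom}(C_o)=\{x\in\mathcal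 H_o:(x,0)\in\operatorname{dom}(S_o)\}$ by $(A_ox,\,C_ox)=S_o(x,0)$. The resolvent set of a closed operator $A$ consists of all $\alpha\in\mathbb C$ such that $\alpha-A$ maps $\operatorname{dom}(A)$ one-to-one onto the space. For $\beta\in\mathbb C^+$, let $\mathcal H_{o,-1}$ be the completion of $\mathcal H_o$ in the norm $\|x\|_{-1}=\|(\beta-A_o)^{-1}x\|$, let $A_o|_{\mathcal H_o}:\mathcal H_o\to\mathcal H_{o,-1}$ be the continuous extension of $A_o$, and let the control operator $B_o:\mathcal U\to\mathcal H_{o,-1}$ be the bounded operator such that for all $(x,u)\in\operatorname{dom}(S_o)$ the first component of $S_o(x,u)$ equals $A_o|_{\mathcal H_o}x+B_ou$ in $\mathcal H_{o,-1}$. Then the following hold (difference quotients at $\mu=\alpha$ are understood as their limits for $\mu\to\alpha$, which exist). 1. $\operatorname{dom}(A_o)=\{x\in\mathcal H_o:\ \exists y\in\mathcal Y,\ (\mu\mapsto\mu x(\mu)-y)\in\mathcal H_o\}$, and for every $x\in\operatorname{dom}(A_o)$ the limit $\lim_{\operatorname{Re}\eta\to\infty}\eta x(\eta)$ exists in $\mathcal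 Y$ and $$(A_ox)(\mu)=\mu x(\mu)-\lim_{\operatorname{Re}\eta\to\infty}\eta x(\eta)\quad(\mu\in\mathbb C^+),\qquad C_ox=\lim_{\operatorname{Re}\eta\to\infty}\eta x(\eta).$$ 2. $A_o$ is closed, $\mathbb C^+$ is contained in its resolvent set, and for all $\alpha,\mu\in\mathbb C^+$ and $x\in\mathcal H_o$ $$\big((\alpha-A_o)^{-1}x\big)(\mu)=\frac{x(\mu)-x(\alpha)}{\alpha-\mu},\qquad \big(A_o(\alpha-A_o)^{-1}x\big)(\mu)=\frac{\mu x(\mu)-\alpha x(\alpha)}{\alpha-\mu},\qquad C_o(\alpha-A_o)^{-1}x=x(\alpha).$$ 3. For every $\beta\in\mathbb C^+$, the operators $A_o|_{\mathcal H_o}$ and $B_o$ exist and are unique, $\alpha-A_o|_{\mathcal H_o}$ is a bijection of $\mathcal H_o$ onto $\mathcal H_{o,-1}$ for all $\alpha\in\mathbb C^+$, and $$\big((\alpha-A_o|_{\mathcal H_o})^{-1}B_ou\big)(\mu)=\frac{\varphi(\mu)-\varphi(\alpha)}{\alpha-\mu}\,u,\qquad \alpha,\mu\in\mathbb C^+,\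 u\in\mathcal U.$$ -/

import Mathlib

open Filter Topology ComplexConjugate

/-! ### The Schur class on the right half-plane and the de Branges-Rovnyak kernel -/

/-- The open right half-plane `ℂ⁺`. -/
abbrev RHP : Type := {μ : ℂ // 0 < μ.re}

/-- The Schur class `𝒮(ℂ⁺; U, Y)`: holomorphic functions on the right half-plane whose values are
contractions from `U` to `Y`. (The values of `toFun` off the half-plane are irrelevant and are
never used.) -/
structure SchurClass (U Y : Type*)
    [NormedAddCommGroup U] [InnerProductSpace ℂ U]
    [NormedAddCommGroup Y] [InnerProductSpace ℂ Y] where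
  toFun : ℂ → U →L[ℂ] Y
  differentiableOn : DifferentiableOn ℂ toFun {μ | 0 < μ.re}
  norm_le_one : ∀ μ : ℂ, 0 < μ.re → ‖toFun μ‖ ≤ 1

instance SchurClass.instCoeFun {U Y : Type*}
    [NormedAddCommGroup U] [InnerProductSpace ℂ U]
    [NormedAddCommGroup Y] [InnerProductSpace ℂ Y] :
    CoeFun (SchurClass U Y) (fun _ => ℂ → U →L[ℂ] Y) := ⟨SchurClass.toFun⟩

/-- The kernel `K_o(μ, l) = (1 - φ(μ) φ(l)^*) / (μ + conj l)` on the right half-plane. -/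
noncomputable def kernelO {U Y : Type*}
    [NormedAddCommGroup U] [InnerProductSpace ℂ U] [CompleteSpace U]
    [NormedAddCommGroup Y] [InnerProductSpace ℂ Y] [CompleteSpace Y]
    (φ : SchurClass U Y) : Matrix RHP RHP (Y →L[ℂ] Y) :=
  Matrix.of fun μ l =>
    ((μ : ℂ) + conj (l : ℂ))⁻¹ •
      (ContinuousLinearMap.id ℂ Y - (φ μ) ∘L (ContinuousLinearMap.adjoint (φ l)))

open Metric in
theorem circleAverage_inner_kernel {E : Type*} [NormedAddCommGroup E] [InnerProductSpace ℂ E]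
    {c : ℂ} {r : ℝ} (hr : 0 < r) {w : ℂ} (hw : w ∈ ball c r) (v : E) {F : ℂ → E}
    (hF : DifferentiableOn ℂ F (closedBall c r)) :
    Real.circleAverage
      (fun ζ => inner ℂ ((1 - (ζ - c) * conj (w - c) / (r : ℂ) ^ 2)⁻¹ • v) (F ζ)) c r
      = inner ℂ v (F w) := by
  have hd : DifferentiableOn ℂ (fun ζ => inner ℂ v (F ζ)) (closedBall c r) := by
    have h1 : DifferentiableOn ℂ (innerSL ℂ v : E → ℂ) Set.univ :=
      (innerSL ℂ v).differentiable.differentiableOn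
    exact h1.comp hF (fun _ _ => Set.mem_univ _)
  have hdc : DiffContOnCl ℂ (fun ζ => inner ℂ v (F ζ)) (ball c |r|) := by
    rw [abs_of_pos hr]
    exact DifferentiableOn.diffContOnCl (by rwa [closure_ball c hr.ne'])
  rw [← hdc.circleAverage_smul_div (w := w) (by rwa [abs_of_pos hr])]
  apply Real.circleAverage_congr_sphere
  intro ζ hζ
  rw [abs_of_pos hr, mem_sphere_iff_norm] at hζ
  have hζ0 : ζ - c ≠ 0 := by
    rw [← norm_pos_iff, hζ]; exact hr
  have hζw : ζ - w ≠ 0 := by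
    intro h
    rw [sub_eq_zero] at h
    rw [mem_ball_iff_norm, ← h, hζ] at hw
    exact lt_irrefl _ hw
  have hconj : conj (ζ - c) * (ζ - c) = (r : ℂ) ^ 2 := by
    rw [mul_comm, Complex.mul_conj, Complex.normSq_eq_norm_sq, hζ]; push_cast; rfl
  have hr0 : (r : ℂ) ^ 2 ≠ 0 := by
    simpa using hr.ne'
  have hc0 : conj (ζ - c) ≠ 0 := by
    intro h; rw [h, zero_mul] at hconj; exact hr0 hconj.symm
  simp only [inner_smul_left, smul_eq_mul]
  congr 1
  rw [map_inv₀, map_sub, map_one, map_div₀, map_mul, Complex.conj_conj, map_pow,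
    Complex.conj_ofReal, ← hconj]
  have : 1 - conj (ζ - c) * (w - c) / (conj (ζ - c) * (ζ - c)) = (ζ - w) / (ζ - c) := by
    field_simp
    ring
  rw [this, inv_div]

open Metric in
theorem circleAverage_inner_sum_kernel {E : Type*} [NormedAddCommGroup E]
    [InnerProductSpace ℂ E] {c : ℂ} {r : ℝ} (hr : 0 < r) {ι : Type*} (s : Finset ι) (p : ι → ℂ)
    (hp : ∀ i ∈ s, p i ∈ ball c r)
    (hkd : ∀ j ∈ s, DifferentiableOn ℂ
      (fun ζ => (1 - (ζ - c) * conj (p j - c) / (r : ℂ) ^ 2)⁻¹) (closedBall c r))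
    (a : ι → E) (F : ℂ → E) (hF : DifferentiableOn ℂ F (closedBall c r)) :
    Real.circleAverage (fun ζ => inner ℂ
      (∑ j ∈ s, (1 - (ζ - c) * conj (p j - c) / (r : ℂ) ^ 2)⁻¹ • a j) (F ζ)) c r
        = ∑ j ∈ s, inner ℂ (a j) (F (p j)) := by
  have hsub : sphere c |r| ⊆ closedBall c r := by
    rw [abs_of_pos hr]; exact sphere_subset_closedBall
  have e : (fun ζ => inner ℂ (∑ j ∈ s, (1 - (ζ - c) * conj (p j - c) / (r : ℂ) ^ 2)⁻¹ • a j) (F ζ))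
      = ∑ j ∈ s, fun ζ => inner ℂ ((1 - (ζ - c) * conj (p j - c) / (r : ℂ) ^ 2)⁻¹ • a j) (F ζ) := by
    funext ζ
    rw [sum_inner, Finset.sum_apply]
  rw [e, Real.circleAverage_sum]
  · refine Finset.sum_congr rfl fun j hj => ?_
    exact circleAverage_inner_kernel hr (hp j hj) (a j) hF
  · intro j hj
    apply ContinuousOn.circleIntegrable'
    exact (((hkd j hj).continuousOn.mono hsub).smul continuousOn_const).inner
      (hF.continuousOn.mono hsub)

open Metric in
theorem schur_disc_positivity {U Y : Type*}
    [NormedAddCommGroup U] [InnerProductSpace ℂ U] [CompleteSpace U]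
    [NormedAddCommGroup Y] [InnerProductSpace ℂ Y] [CompleteSpace Y]
    {φ : ℂ → U →L[ℂ] Y} {c : ℂ} {r : ℝ} (hr : 0 < r)
    (hφ : DifferentiableOn ℂ φ (closedBall c r)) (hn : ∀ ζ ∈ closedBall c r, ‖φ ζ‖ ≤ 1)
    {ι : Type*} (s : Finset ι) (p : ι → ℂ) (hp : ∀ i ∈ s, p i ∈ ball c r) (v : ι → Y) :
    0 ≤ (∑ i ∈ s, ∑ j ∈ s, (1 - (p i - c) * conj (p j - c) / (r : ℂ) ^ 2)⁻¹ *
      inner ℂ (v i) (v j - φ (p i) ((φ (p j)).adjoint (v j)))).re := by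
  set k : ι → ℂ → ℂ := fun j ζ => (1 - (ζ - c) * conj (p j - c) / (r : ℂ) ^ 2)⁻¹ with hk
  set h : ℂ → Y := fun ζ => ∑ j ∈ s, k j ζ • v j with hh
  set g : ℂ → U := fun ζ => ∑ j ∈ s, k j ζ • (φ (p j)).adjoint (v j) with hg
  have hkd : ∀ j ∈ s, DifferentiableOn ℂ (k j) (closedBall c r) := by
    intro j hj ζ hζ
    have hne : 1 - (ζ - c) * conj (p j - c) / (r : ℂ) ^ 2 ≠ 0 := by
      intro h0
      have h1 : (ζ - c) * conj (p j - c) / (r : ℂ) ^ 2 = 1 := (sub_eq_zero.mp h0).symm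
      have h2 := congrArg norm h1
      rw [norm_div, norm_mul, RCLike.norm_conj, norm_pow, Complex.norm_real, Real.norm_eq_abs,
        sq_abs, norm_one, div_eq_one_iff_eq (by positivity)] at h2
      have h3 := hp j hj
      rw [mem_ball_iff_norm] at h3
      rw [mem_closedBall_iff_norm] at hζ
      nlinarith [norm_nonneg (ζ - c), norm_nonneg (p j - c)]
    have : DifferentiableAt ℂ (k j) ζ := by
      simp only [hk]
      exact DifferentiableAt.inv (by fun_prop) hne
    exact this.differentiableWithinAt
  have hhd : DifferentiableOn ℂ h (closedBall c r) :=
    DifferentiableOn.fun_sum fun j hj => (hkd j hj).smul_const _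
  have hgd : DifferentiableOn ℂ g (closedBall c r) :=
    DifferentiableOn.fun_sum fun j hj => (hkd j hj).smul_const _
  have hfd : DifferentiableOn ℂ (fun ζ => φ ζ (g ζ)) (closedBall c r) := hφ.clm_apply hgd
  have hsub : sphere c |r| ⊆ closedBall c r := by
    rw [abs_of_pos hr]; exact sphere_subset_closedBall
  -- averages
  have E1 := circleAverage_inner_sum_kernel hr s p hp hkd v h hhd
  have E2 := circleAverage_inner_sum_kernel hr s p hp hkd (fun j => (φ (p j)).adjoint (v j)) g hgd
  have E3 := circleAverage_inner_sum_kernel hr s p hp hkd v (fun ζ => φ ζ (g ζ)) hfd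
  have E3' : ∑ j ∈ s, inner ℂ (v j) (φ (p j) (g (p j)))
      = ∑ j ∈ s, inner ℂ ((φ (p j)).adjoint (v j)) (g (p j)) := by
    simp only [ContinuousLinearMap.adjoint_inner_left]
  have i1 : CircleIntegrable (fun ζ => inner ℂ (h ζ) (h ζ)) c r :=
    ContinuousOn.circleIntegrable' ((hhd.continuousOn.mono hsub).inner (hhd.continuousOn.mono hsub))
  have i2 : CircleIntegrable (fun ζ => inner ℂ (g ζ) (g ζ)) c r :=
    ContinuousOn.circleIntegrable' ((hgd.continuousOn.mono hsub).inner (hgd.continuousOn.mono hsub))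
  have i3 : CircleIntegrable (fun ζ => inner ℂ (h ζ) (φ ζ (g ζ))) c r :=
    ContinuousOn.circleIntegrable' ((hhd.continuousOn.mono hsub).inner (hfd.continuousOn.mono hsub))
  have re_avg : ∀ {f : ℂ → ℂ}, CircleIntegrable f c r →
      (Real.circleAverage f c r).re = (2 * Real.pi)⁻¹ *
        ∫ θ in 0..2 * Real.pi, (f (circleMap c r θ)).re := by
    intro f hf
    have := Complex.reCLM.intervalIntegral_comp_comm (μ := MeasureTheory.volume) hf
    rw [Real.circleAverage, Complex.smul_re, smul_eq_mul]
    congr 1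
    exact this.symm
  have ir : ∀ {f : ℂ → ℂ}, CircleIntegrable f c r → IntervalIntegrable
      (fun θ => (f (circleMap c r θ)).re) MeasureTheory.volume 0 (2 * Real.pi) := by
    intro f hf
    exact ⟨hf.1.re, hf.2.re⟩
  have r1 := re_avg i1
  have r2 := re_avg i2
  have r3 := re_avg i3
  have hpos : 0 ≤ ∫ θ in 0..2 * Real.pi,
      (((inner ℂ (h (circleMap c r θ)) (h (circleMap c r θ)) : ℂ).re
        - 2 * (inner ℂ (h (circleMap c r θ)) (φ (circleMap c r θ) (g (circleMap c r θ))) : ℂ).re)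
        + (inner ℂ (g (circleMap c r θ)) (g (circleMap c r θ)) : ℂ).re) := by
    apply intervalIntegral.integral_nonneg (by positivity)
    intro θ _
    set ζ := circleMap c r θ
    have hζ : ζ ∈ closedBall c r := hsub (circleMap_mem_sphere' c r θ)
    have h1 : ‖φ ζ (g ζ)‖ ≤ ‖g ζ‖ := by
      calc ‖φ ζ (g ζ)‖ ≤ ‖φ ζ‖ * ‖g ζ‖ := (φ ζ).le_opNorm _
        _ ≤ 1 * ‖g ζ‖ := by gcongr; exact hn ζ hζ
        _ = ‖g ζ‖ := one_mul _
    have h2 := norm_sub_sq (𝕜 := ℂ) (h ζ) (φ ζ (g ζ))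
    have h3 : (inner ℂ (h ζ) (h ζ) : ℂ).re = ‖h ζ‖ ^ 2 := inner_self_eq_norm_sq (𝕜 := ℂ) _
    have h4 : (inner ℂ (g ζ) (g ζ) : ℂ).re = ‖g ζ‖ ^ 2 := inner_self_eq_norm_sq (𝕜 := ℂ) _
    rw [h3, h4]
    simp only [RCLike.re_to_complex] at h2
    have h5 := pow_le_pow_left₀ (norm_nonneg _) h1 2
    have h6 := sq_nonneg ‖h ζ - φ ζ (g ζ)‖
    linarith
  rw [intervalIntegral.integral_add ((ir i1).sub ((ir i3).const_mul 2)) (ir i2),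
    intervalIntegral.integral_sub (ir i1) ((ir i3).const_mul 2),
    intervalIntegral.integral_const_mul] at hpos
  have hfin : 0 ≤ (∑ j ∈ s, inner ℂ (v j) (h (p j))).re
      - (∑ j ∈ s, inner ℂ ((φ (p j)).adjoint (v j)) (g (p j))).re := by
    have a1 := r1
    have a2 := r2
    have a3 := r3
    rw [E1] at a1
    rw [E2] at a2
    rw [E3, E3', a2] at a3
    rw [a1, a2]
    have hpi : (0 : ℝ) < (2 * Real.pi)⁻¹ := by positivity
    have a4 := mul_left_cancel₀ hpi.ne' a3
    rw [← a4] at hpos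
    rw [← mul_sub]
    apply mul_nonneg hpi.le
    linarith
  rw [← Complex.sub_re, ← Finset.sum_sub_distrib] at hfin
  convert hfin using 2
  refine Finset.sum_congr rfl fun i _ => ?_
  simp only [hh, hg, inner_sum, ← Finset.sum_sub_distrib]
  refine Finset.sum_congr rfl fun j _ => ?_
  rw [inner_smul_right, inner_smul_right, ContinuousLinearMap.adjoint_inner_left, ← mul_sub,
    ← inner_sub_right]

theorem kernelO_apply {U Y : Type*}
    [NormedAddCommGroup U] [InnerProductSpace ℂ U] [CompleteSpace U]
    [NormedAddCommGroup Y] [InnerProductSpace ℂ Y] [CompleteSpace Y]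
    (φ : SchurClass U Y) (μ l : RHP) (y : Y) :
    kernelO φ μ l y = ((μ : ℂ) + conj (l : ℂ))⁻¹ • (y - φ μ ((φ l).adjoint y)) := rfl

open Metric in
theorem schur_halfPlane_positivity {U Y : Type*}
    [NormedAddCommGroup U] [InnerProductSpace ℂ U] [CompleteSpace U]
    [NormedAddCommGroup Y] [InnerProductSpace ℂ Y] [CompleteSpace Y]
    (φ : SchurClass U Y) (s : Finset RHP) (v : RHP → Y) :
    0 ≤ (∑ i ∈ s, ∑ j ∈ s, inner ℂ (v i) (kernelO φ i j (v j))).re := by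
  have hlim : Tendsto (fun R : ℝ => (∑ i ∈ s, ∑ j ∈ s,
      (((i : ℂ) + conj (j : ℂ)) - ((i : ℂ) * conj (j : ℂ) + 1) * (R⁻¹ : ℝ))⁻¹ *
      inner ℂ (v i) (v j - φ i ((φ j).adjoint (v j)))).re) atTop
      (𝓝 (∑ i ∈ s, ∑ j ∈ s, inner ℂ (v i) (kernelO φ i j (v j))).re) := by
    refine (Complex.continuous_re.tendsto _).comp ?_
    refine tendsto_finsetSum _ fun i _ => tendsto_finsetSum _ fun j _ => ?_
    have hne : (i : ℂ) + conj (j : ℂ) ≠ 0 := by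
      intro h0
      have := congrArg Complex.re h0
      simp only [Complex.add_re, Complex.conj_re, Complex.zero_re] at this
      linarith [i.2, j.2]
    have h1 : Tendsto (fun R : ℝ => ((R⁻¹ : ℝ) : ℂ)) atTop (𝓝 0) := by
      have := (Complex.continuous_ofReal.tendsto 0).comp tendsto_inv_atTop_zero
      rw [Complex.ofReal_zero] at this
      exact this
    have h2 : Tendsto (fun R : ℝ => (((i : ℂ) + conj (j : ℂ)) -
        ((i : ℂ) * conj (j : ℂ) + 1) * (R⁻¹ : ℝ))⁻¹) atTop (𝓝 ((i : ℂ) + conj (j : ℂ))⁻¹) := by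
      have := (tendsto_const_nhds (x := (i : ℂ) + conj (j : ℂ))).sub
        (h1.const_mul ((i : ℂ) * conj (j : ℂ) + 1))
      rw [mul_zero, sub_zero] at this
      exact this.inv₀ hne
    have h3 := h2.mul_const (inner ℂ (v i) (v j - φ i ((φ j).adjoint (v j))))
    convert h3 using 2
    simp [kernelO_apply]
  refine ge_of_tendsto hlim ?_
  have hev : ∀ᶠ R : ℝ in atTop, 1 < R ∧ ∀ i ∈ s, ‖(i : ℂ)‖ ^ 2 + 1 < 2 * R * (i : ℂ).re := by
    refine (eventually_gt_atTop 1).and ?_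
    rw [Finset.eventually_all]
    intro i _
    filter_upwards [eventually_gt_atTop ((‖(i : ℂ)‖ ^ 2 + 1) / (2 * (i : ℂ).re))] with R hR
    rw [div_lt_iff₀ (by linarith [i.2])] at hR
    linarith
  filter_upwards [hev] with R hR
  obtain ⟨hR1, hR2⟩ := hR
  have hq : 0 < R ^ 2 - 1 := by nlinarith
  set r := √(R ^ 2 - 1) with hr
  have hr0 : 0 < r := Real.sqrt_pos.mpr hq
  have hrsq : r ^ 2 = R ^ 2 - 1 := Real.sq_sqrt hq.le
  have hrR : r < R := by nlinarith
  have hsub : closedBall (R : ℂ) r ⊆ {μ : ℂ | 0 < μ.re} := by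
    intro ζ hζ
    rw [mem_closedBall_iff_norm] at hζ
    have h1 := (Complex.abs_re_le_norm (ζ - R)).trans hζ
    have h2 := (abs_le.mp h1).1
    simp only [Complex.sub_re, Complex.ofReal_re] at h2
    show 0 < ζ.re
    linarith
  have hp : ∀ i ∈ s, (i : ℂ) ∈ ball (R : ℂ) r := by
    intro i hi
    rw [mem_ball_iff_norm]
    refine lt_of_pow_lt_pow_left₀ 2 hr0.le ?_
    have h1 := hR2 i hi
    have h2 : ‖(i : ℂ) - R‖ ^ 2 = ‖(i : ℂ)‖ ^ 2 - 2 * R * (i : ℂ).re + R ^ 2 := by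
      rw [← Complex.normSq_eq_norm_sq, ← Complex.normSq_eq_norm_sq, Complex.normSq_apply,
        Complex.normSq_apply]
      simp
      ring
    rw [h2, hrsq]
    linarith
  have hmain := schur_disc_positivity hr0 (φ.differentiableOn.mono hsub)
    (fun ζ hζ => φ.norm_le_one ζ (hsub hζ)) s (fun i : RHP => (i : ℂ)) hp v
  have hfac : ∀ i ∈ s, ∀ j ∈ s,
      (((i : ℂ) + conj (j : ℂ)) - ((i : ℂ) * conj (j : ℂ) + 1) * (R⁻¹ : ℝ))⁻¹
      = ((R / r ^ 2 : ℝ) : ℂ) * (1 - ((i : ℂ) - R) * conj ((j : ℂ) - R) / (r : ℂ) ^ 2)⁻¹ := by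
    intro i _ j _
    have hRc : (R : ℂ) ≠ 0 := by
      have : R ≠ 0 := by linarith
      exact_mod_cast this
    have hrc : (r : ℂ) ≠ 0 := by exact_mod_cast hr0.ne'
    have hrsqc : (r : ℂ) ^ 2 = (R : ℂ) ^ 2 - 1 := by exact_mod_cast hrsq
    have e1 : ((i : ℂ) + conj (j : ℂ)) - ((i : ℂ) * conj (j : ℂ) + 1) * (R⁻¹ : ℝ)
        = ((r : ℂ) ^ 2 / R) * (1 - ((i : ℂ) - R) * conj ((j : ℂ) - R) / (r : ℂ) ^ 2) := by
      rw [map_sub, Complex.conj_ofReal, Complex.ofReal_inv]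
      field_simp
      rw [hrsqc]
      ring
    rw [e1, mul_inv, inv_div]
    push_cast
    rfl
  have hre : (∑ i ∈ s, ∑ j ∈ s,
      (((i : ℂ) + conj (j : ℂ)) - ((i : ℂ) * conj (j : ℂ) + 1) * (R⁻¹ : ℝ))⁻¹ *
      inner ℂ (v i) (v j - φ i ((φ j).adjoint (v j))))
      = ((R / r ^ 2 : ℝ) : ℂ) * ∑ i ∈ s, ∑ j ∈ s,
        (1 - ((i : ℂ) - R) * conj ((j : ℂ) - R) / (r : ℂ) ^ 2)⁻¹ *
        inner ℂ (v i) (v j - φ i ((φ j).adjoint (v j))) := by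
    rw [Finset.mul_sum]
    refine Finset.sum_congr rfl fun i hi => ?_
    rw [Finset.mul_sum]
    refine Finset.sum_congr rfl fun j hj => ?_
    rw [hfac i hi j hj, mul_assoc]
  rw [hre, Complex.re_ofReal_mul]
  exact mul_nonneg (div_nonneg (by linarith) (by positivity)) hmain

open scoped ComplexOrder in
/-- The kernel `K_o` is a positive kernel. -/
theorem posSemidef_kernelO {U Y : Type*}
    [NormedAddCommGroup U] [InnerProductSpace ℂ U] [CompleteSpace U]
    [NormedAddCommGroup Y] [InnerProductSpace ℂ Y] [CompleteSpace Y]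
    (φ : SchurClass U Y) : (kernelO φ).PosSemidef := by
  have hherm : (kernelO φ).IsHermitian := by
    ext i j y
    refine ext_inner_left ℂ fun w => ?_
    rw [Matrix.conjTranspose_apply, ContinuousLinearMap.star_eq_adjoint,
      ContinuousLinearMap.adjoint_inner_right, kernelO_apply, kernelO_apply, inner_smul_left,
      inner_smul_right, inner_sub_left, inner_sub_right, ← ContinuousLinearMap.adjoint_inner_right,
      ContinuousLinearMap.adjoint_inner_left, map_inv₀, map_add, Complex.conj_conj, add_comm]
  have htfae := (RKHS.posSemidef_tfae (K := kernelO φ)).out 0 2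
  refine htfae.mpr ⟨hherm, fun vv => ?_⟩
  have h := schur_halfPlane_positivity φ vv.support vv
  rw [← RCLike.conj_re]
  simp only [Finsupp.sum, map_sum, inner_conj_symm, RCLike.re_to_complex]
  rw [Finset.sum_comm]
  simpa only [Complex.re_sum] using h

instance fact_posSemidef_kernelO {U Y : Type*}
    [NormedAddCommGroup U] [InnerProductSpace ℂ U] [CompleteSpace U]
    [NormedAddCommGroup Y] [InnerProductSpace ℂ Y] [CompleteSpace Y]
    (φ : SchurClass U Y) : Fact (kernelO φ).PosSemidef := ⟨posSemidef_kernelO φ⟩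

/-! ### Operators attached to a node -/

section Nodes

variable {X U Y : Type*}
  [NormedAddCommGroup X] [InnerProductSpace ℂ X]
  [NormedAddCommGroup U] [InnerProductSpace ℂ U]
  [NormedAddCommGroup Y] [InnerProductSpace ℂ Y]

/-- The main operator `A` of `S = [A&B; C&D]`: `A x = [A&B] (x, 0)`, with domain the set of
all `x` such that `(x, 0)` lies in the domain of `S`. -/
noncomputable def mainOperator
    (S : WithLp 2 (X × U) →ₗ.[ℂ] WithLp 2 (X × Y)) : X →ₗ.[ℂ] X where
  domain :=
    { carrier := {x | WithLp.toLp 2 (x, (0 : U)) ∈ S.domain}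
      zero_mem' := S.domain.zero_mem
      add_mem' := by
        intro a b ha hb
        have h := S.domain.add_mem ha hb
        rw [← WithLp.toLp_add, Prod.mk_add_mk, add_zero] at h
        exact h
      smul_mem' := by
        intro c a ha
        have h := S.domain.smul_mem c ha
        rw [← WithLp.toLp_smul, Prod.smul_mk, smul_zero] at h
        exact h }
  toFun :=
    { toFun := fun x => (S ⟨WithLp.toLp 2 ((x : X), (0 : U)), x.2⟩).fst
      map_add' := by
        intro a b
        rw [← WithLp.add_fst, ← S.map_add]
        congr 2
        exact Subtype.ext (by simp [← WithLp.toLp_add])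
      map_smul' := by
        intro c a
        rw [RingHom.id_apply, ← WithLp.smul_fst, ← S.map_smul]
        congr 2
        exact Subtype.ext (by simp [← WithLp.toLp_smul]) }

/-- The observation operator `C` of `S = [A&B; C&D]`: `C x = [C&D] (x, 0)`, defined on the domain
of the main operator. -/
noncomputable def observationOperator
    (S : WithLp 2 (X × U) →ₗ.[ℂ] WithLp 2 (X × Y)) : (mainOperator S).domain →ₗ[ℂ] Y where
  toFun := fun x => (S ⟨WithLp.toLp 2 ((x : X), (0 : U)), x.2⟩).snd
  map_add' := by
    intro a b
    rw [← WithLp.add_snd, ← S.map_add]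
    congr 2
    exact Subtype.ext (by simp [← WithLp.toLp_add])
  map_smul' := by
    intro c a
    rw [RingHom.id_apply, ← WithLp.smul_snd, ← S.map_smul]
    congr 2
    exact Subtype.ext (by simp [← WithLp.toLp_smul])

/-- The operator `α - A`, as a linear map on the domain of `A`. -/
def shiftOp (A : X →ₗ.[ℂ] X) (α : ℂ) : A.domain →ₗ[ℂ] X :=
  α • A.domain.subtype - A.toFun

/-- The resolvent set of an operator `A` on `X`: all `α` such that `α - A` maps the domain of `A`
one-to-one onto `X`. -/
def resolventSetOp (A : X →ₗ.[ℂ] X) : Set ℂ :=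
  {α | Function.Bijective (shiftOp A α)}

open Classical in
/-- The resolvent `(α - A)⁻¹`, as a map from `X` onto the domain of `A`
(it is set to `0` if `α` is not in the resolvent set). -/
noncomputable def resolventOp (A : X →ₗ.[ℂ] X) (α : ℂ) : X →ₗ[ℂ] A.domain :=
  if h : Function.Bijective (shiftOp A α) then
    ((LinearEquiv.ofBijective (shiftOp A α) h).symm : X →ₗ[ℂ] A.domain)
  else 0

/-- The space `X` with the norm `‖x‖_{-1} = ‖(β - A)⁻¹ x‖`. -/
@[nolint unusedArguments]
def WeakNormed (_A : X →ₗ.[ℂ] X) (_β : ℂ) : Type _ := X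

instance WeakNormed.instAddCommGroup (A : X →ₗ.[ℂ] X) (β : ℂ) :
    AddCommGroup (WeakNormed A β) := inferInstanceAs (AddCommGroup X)

instance WeakNormed.instModule (A : X →ₗ.[ℂ] X) (β : ℂ) :
    Module ℂ (WeakNormed A β) := inferInstanceAs (Module ℂ X)

/-- `(β - A)⁻¹` as a map on `X` with the weak norm. -/
noncomputable def WeakNormed.res (A : X →ₗ.[ℂ] X) (β : ℂ) : WeakNormed A β →ₗ[ℂ] X :=
  A.domain.subtype ∘ₗ resolventOp A β

noncomputable instance WeakNormed.instSeminormedAddCommGroup (A : X →ₗ.[ℂ] X) (β : ℂ) :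
    SeminormedAddCommGroup (WeakNormed A β) :=
  SeminormedAddCommGroup.induced _ _ (WeakNormed.res A β)

noncomputable instance WeakNormed.instNormedSpace (A : X →ₗ.[ℂ] X) (β : ℂ) :
    NormedSpace ℂ (WeakNormed A β) :=
  NormedSpace.induced ℂ _ _ (WeakNormed.res A β)

/-- The rigged space `X_{-1}`: the completion of `X` in the norm `‖x‖_{-1} = ‖(β - A)⁻¹ x‖`. -/
abbrev RiggedSpace (A : X →ₗ.[ℂ] X) (β : ℂ) : Type _ :=
  UniformSpace.Completion (WeakNormed A β)

/-- The inclusion of `X` into `X_{-1}`. -/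
noncomputable def riggedIncl (A : X →ₗ.[ℂ] X) (β : ℂ) (x : X) : RiggedSpace A β :=
  UniformSpace.Completion.coe' (α := WeakNormed A β) x

/-- `T : X → X_{-1}` is a continuous extension of `A`, that is, `T = A|_X`. -/
def IsRiggedExtension (A : X →ₗ.[ℂ] X) (β : ℂ) (T : X →L[ℂ] RiggedSpace A β) : Prop :=
  ∀ x : A.domain, T x = riggedIncl A β (A x)

/-- `B : U → X_{-1}` is a control operator of `S = [A&B; C&D]`, where `T = A|_X`: the bounded
operator `[T B] : X × U → X_{-1}` extends `[A&B]`. -/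
def IsControlOperator (S : WithLp 2 (X × U) →ₗ.[ℂ] WithLp 2 (X × Y)) (β : ℂ)
    (T : X →L[ℂ] RiggedSpace (mainOperator S) β)
    (B : U →L[ℂ] RiggedSpace (mainOperator S) β) : Prop :=
  ∀ w : S.domain,
    riggedIncl (mainOperator S) β (S w).fst
      = T (w : WithLp 2 (X × U)).fst + B (w : WithLp 2 (X × U)).snd

end Nodes

/-- The function `g` on the right half-plane is `μ ↦ (f μ - f α) / (α - μ)`, where the value at
`μ = α` is understood as the limit of the quotient (the singularity is removable). -/
def IsDiffQuot {Y : Type*} [NormedAddCommGroup Y] [NormedSpace ℂ Y]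
    (f : RHP → Y) (α : RHP) (g : RHP → Y) : Prop :=
  (∀ μ : RHP, μ ≠ α → g μ = ((α : ℂ) - μ)⁻¹ • (f μ - f α)) ∧
    Tendsto (fun μ : RHP => ((α : ℂ) - μ)⁻¹ • (f μ - f α)) (𝓝[≠] α) (𝓝 (g α))

/-- The filter on the right half-plane which describes `Re η → ∞`. -/
noncomputable def reAtTop : Filter RHP := comap (fun η : RHP => (η : ℂ).re) atTop

/-! ### The state space and the observable model -/

/-- The de Branges-Rovnyak space `ℋ_o`: the Hilbert space of `Y`-valued functions on the right
half-plane with reproducing kernel `K_o`. -/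
abbrev Ho {U Y : Type*}
    [NormedAddCommGroup U] [InnerProductSpace ℂ U] [CompleteSpace U]
    [NormedAddCommGroup Y] [InnerProductSpace ℂ Y] [CompleteSpace Y]
    (φ : SchurClass U Y) : Type _ := RKHS.OfKernel (kernelO φ)

section Model

variable {U Y : Type*}
  [NormedAddCommGroup U] [InnerProductSpace ℂ U] [CompleteSpace U]
  [NormedAddCommGroup Y] [InnerProductSpace ℂ Y] [CompleteSpace Y]

/-- The closed linear span of all pairs
`((e_o(l)^* y, y), (conj l • e_o(l)^* y, φ(l)^* y))`, `l` in the right half-plane, `y` in `Y`, where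
`e_o(l)^* y = K_o(·, l) y` is the kernel function. -/
noncomputable def dualGraph (φ : SchurClass U Y) :
    Submodule ℂ (WithLp 2 (Ho φ × Y) × WithLp 2 (Ho φ × U)) :=
  (Submodule.span ℂ {q | ∃ (l : RHP) (y : Y),
    q = (WithLp.toLp 2 (RKHS.kerFun (Ho φ) l y, y),
      WithLp.toLp 2 (conj (l : ℂ) • RKHS.kerFun (Ho φ) l y,
        ContinuousLinearMap.adjoint (φ l) y))}).topologicalClosure

/-- The closed operator `[A&B; C&D]_o^*`, obtained from
`(e_o(l)^* y, y) ↦ (conj l • e_o(l)^* y, φ(l)^* y)` by linearity and limit-closure. -/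
noncomputable def dualNode (φ : SchurClass U Y) :
    WithLp 2 (Ho φ × Y) →ₗ.[ℂ] WithLp 2 (Ho φ × U) :=
  (dualGraph φ).toLinearPMap

/-- The observable co-energy-preserving model `[A&B; C&D]_o`: the adjoint of `dualNode φ`. -/
noncomputable def observableModel (φ : SchurClass U Y) :
    WithLp 2 (Ho φ × U) →ₗ.[ℂ] WithLp 2 (Ho φ × Y) :=
  (dualNode φ).adjoint

theorem inner_kerFun_kerFun (φ : SchurClass U Y) (l m : RHP) (y w : Y) :
    ((l : ℂ) + conj (m : ℂ)) *
      inner ℂ (RKHS.kerFun (Ho φ) l y) (RKHS.kerFun (Ho φ) m w)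
      = inner ℂ y w - inner ℂ ((φ l).adjoint y) ((φ m).adjoint w) := by
  have hne : (l : ℂ) + conj (m : ℂ) ≠ 0 := by
    intro h0
    have := congrArg Complex.re h0
    simp only [Complex.add_re, Complex.conj_re, Complex.zero_re] at this
    linarith [l.2, m.2]
  rw [← RKHS.kernel_inner, RKHS.OfKernel.kernel_ofKernel, kernelO_apply, inner_smul_left,
    map_inv₀, map_add, Complex.conj_conj, inner_sub_left,
    ← ContinuousLinearMap.adjoint_inner_right, add_comm (conj (m : ℂ)), mul_inv_cancel_left₀ hne]

/-- The operator `[A&B; C&D]_o^*` is scattering isometric. -/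
theorem dualGraph_isometric (φ : SchurClass U Y) {p q : WithLp 2 (Ho φ × Y) × WithLp 2 (Ho φ × U)}
    (hp : p ∈ dualGraph φ) (hq : q ∈ dualGraph φ) :
    inner ℂ p.2.fst q.1.fst + inner ℂ p.1.fst q.2.fst
      - (inner ℂ p.1.snd q.1.snd - inner ℂ p.2.snd q.2.snd) = 0 := by
  have c1 : Continuous fun p : WithLp 2 (Ho φ × Y) × WithLp 2 (Ho φ × U) => p.1.fst := by fun_prop
  have c2 : Continuous fun p : WithLp 2 (Ho φ × Y) × WithLp 2 (Ho φ × U) => p.1.snd := by fun_prop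
  have c3 : Continuous fun p : WithLp 2 (Ho φ × Y) × WithLp 2 (Ho φ × U) => p.2.fst := by fun_prop
  have c4 : Continuous fun p : WithLp 2 (Ho φ × Y) × WithLp 2 (Ho φ × U) => p.2.snd := by fun_prop
  have cl : ∀ q : WithLp 2 (Ho φ × Y) × WithLp 2 (Ho φ × U),
      IsClosed {p : WithLp 2 (Ho φ × Y) × WithLp 2 (Ho φ × U) |
        inner ℂ p.2.fst q.1.fst + inner ℂ p.1.fst q.2.fst
          - (inner ℂ p.1.snd q.1.snd - inner ℂ p.2.snd q.2.snd) = 0} := fun q =>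
    isClosed_eq (((c3.inner continuous_const).add (c1.inner continuous_const)).sub
      ((c2.inner continuous_const).sub (c4.inner continuous_const))) continuous_const
  have cr : ∀ p : WithLp 2 (Ho φ × Y) × WithLp 2 (Ho φ × U),
      IsClosed {q : WithLp 2 (Ho φ × Y) × WithLp 2 (Ho φ × U) |
        inner ℂ p.2.fst q.1.fst + inner ℂ p.1.fst q.2.fst
          - (inner ℂ p.1.snd q.1.snd - inner ℂ p.2.snd q.2.snd) = 0} := fun p =>
    isClosed_eq (((continuous_const.inner c1).add (continuous_const.inner c3)).sub
      ((continuous_const.inner c2).sub (continuous_const.inner c4))) continuous_const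
  rw [dualGraph, ← SetLike.mem_coe, Submodule.topologicalClosure_coe] at hp hq
  refine closure_minimal (fun p hp => ?_) (cl q) hp
  refine closure_minimal (fun q hq => ?_) (cr p) hq
  simp only [Set.mem_ofPred_eq]
  refine Submodule.span_induction ?_ ?_ ?_ ?_ hp
  · rintro _ ⟨l, y, rfl⟩
    refine Submodule.span_induction ?_ ?_ ?_ ?_ hq
    · rintro _ ⟨m, w, rfl⟩
      change inner ℂ (conj (l : ℂ) • RKHS.kerFun (Ho φ) l y) (RKHS.kerFun (Ho φ) m w)
        + inner ℂ (RKHS.kerFun (Ho φ) l y) (conj (m : ℂ) • RKHS.kerFun (Ho φ) m w)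
        - (inner ℂ y w - inner ℂ ((φ l).adjoint y) ((φ m).adjoint w)) = 0
      rw [inner_smul_left, inner_smul_right, Complex.conj_conj, ← inner_kerFun_kerFun]
      ring
    · simp
    · intro a b _ _ ha hb
      simp only [Prod.fst_add, Prod.snd_add, WithLp.add_fst, WithLp.add_snd, inner_add_right]
      linear_combination ha + hb
    · intro c a _ ha
      simp only [Prod.smul_fst, Prod.smul_snd, WithLp.smul_fst, WithLp.smul_snd, inner_smul_right]
      linear_combination c * ha
  · simp
  · intro a b _ _ ha hb
    simp only [Prod.fst_add, Prod.snd_add, WithLp.add_fst, WithLp.add_snd, inner_add_left]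
    linear_combination ha + hb
  · intro c a _ ha
    simp only [Prod.smul_fst, Prod.smul_snd, WithLp.smul_fst, WithLp.smul_snd, inner_smul_left]
    linear_combination conj c * ha

theorem mem_dualGraph (φ : SchurClass U Y) (l : RHP) (y : Y) :
    (WithLp.toLp 2 (RKHS.kerFun (Ho φ) l y, y),
      WithLp.toLp 2 (conj (l : ℂ) • RKHS.kerFun (Ho φ) l y, (φ l).adjoint y)) ∈ dualGraph φ :=
  Submodule.le_topologicalClosure _ (Submodule.subset_span ⟨l, y, rfl⟩)

/-- `dualGraph φ` is the graph of an operator. -/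
theorem dualGraph_singleValued (φ : SchurClass U Y)
    (p : WithLp 2 (Ho φ × Y) × WithLp 2 (Ho φ × U)) (hp : p ∈ dualGraph φ) (h0 : p.1 = 0) :
    p.2 = 0 := by
  have hs : p.2.snd = 0 := by
    have h := dualGraph_isometric φ hp hp
    simpa [h0] using h
  have hf : p.2.fst = 0 := by
    refine RKHS.ext fun l => ext_inner_right ℂ fun y => ?_
    have h := dualGraph_isometric φ hp (mem_dualGraph φ l y)
    simpa [h0, hs] using h
  exact WithLp.ofLp_injective 2 (Prod.ext hf hs)

theorem graph_dualNode (φ : SchurClass U Y) : (dualNode φ).graph = dualGraph φ :=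
  (dualGraph φ).toLinearPMap_graph_eq (dualGraph_singleValued φ)

/-- `[A&B; C&D]_o^*` is densely defined. -/
theorem dense_dualNode_domain (φ : SchurClass U Y) :
    Dense ((dualNode φ).domain : Set (WithLp 2 (Ho φ × Y))) := by
  rw [Submodule.dense_iff_topologicalClosure_eq_top, Submodule.topologicalClosure_eq_top_iff,
    Submodule.eq_bot_iff]
  intro v hv
  have h1 : ∀ l : RHP, v.fst l + v.snd = 0 := by
    intro l
    refine ext_inner_left ℂ fun y => ?_
    have hm : WithLp.toLp 2 (RKHS.kerFun (Ho φ) l y, y) ∈ (dualNode φ).domain :=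
      ⟨_, mem_dualGraph φ l y, rfl⟩
    have h := (Submodule.mem_orthogonal _ _).mp hv _ hm
    simpa [WithLp.prod_inner_apply, inner_add_right] using h
  have h2 : v.snd = 0 := by
    -- the values `v.fst l` are constant, and tend to `0` as `l → ∞`
    have hb : ∀ t : ℝ, 0 < t → 2 * t * ‖v.snd‖ ^ 2 ≤ ‖v.fst‖ ^ 2 := by
      intro t ht
      have hl : v.fst ⟨(t : ℂ), by simpa using ht⟩ = -v.snd := eq_neg_of_add_eq_zero_left (h1 _)
      set l : RHP := ⟨(t : ℂ), by simpa using ht⟩ with hldef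
      have e1 := RKHS.norm_apply_le v.fst l
      have e2 : ‖RKHS.kernel (Ho φ) l l‖ ≤ (2 * t)⁻¹ := by
        rw [RKHS.norm_kernel_eq_norm_kerFun_sq]
        have e3 : ‖RKHS.kerFun (Ho φ) l‖ ≤ √((2 * t)⁻¹) := by
          refine ContinuousLinearMap.opNorm_le_bound _ (Real.sqrt_nonneg _) fun y => ?_
          have e4 := inner_kerFun_kerFun φ l l y y
          have e5 : (2 * t) * ‖RKHS.kerFun (Ho φ) l y‖ ^ 2 = ‖y‖ ^ 2 - ‖(φ l).adjoint y‖ ^ 2 := by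
            rw [inner_self_eq_norm_sq_to_K, inner_self_eq_norm_sq_to_K,
              inner_self_eq_norm_sq_to_K] at e4
            simp only [hldef, Complex.conj_ofReal, Complex.coe_algebraMap] at e4
            have e6 := congrArg Complex.re e4
            norm_cast at e6
            linarith
          have e7 : ‖RKHS.kerFun (Ho φ) l y‖ ^ 2 ≤ (2 * t)⁻¹ * ‖y‖ ^ 2 := by
            rw [inv_mul_eq_div, le_div_iff₀ (by positivity)]
            nlinarith [sq_nonneg ‖(φ l).adjoint y‖]
          calc ‖RKHS.kerFun (Ho φ) l y‖ = √(‖RKHS.kerFun (Ho φ) l y‖ ^ 2) :=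
                (Real.sqrt_sq (norm_nonneg _)).symm
            _ ≤ √((2 * t)⁻¹ * ‖y‖ ^ 2) := Real.sqrt_le_sqrt e7
            _ = √((2 * t)⁻¹) * ‖y‖ := by
                rw [Real.sqrt_mul (by positivity), Real.sqrt_sq (norm_nonneg _)]
        calc ‖RKHS.kerFun (Ho φ) l‖ ^ 2 ≤ √((2 * t)⁻¹) ^ 2 := by gcongr
          _ = (2 * t)⁻¹ := Real.sq_sqrt (by positivity)
      rw [hl, norm_neg] at e1
      have e8 : ‖v.snd‖ ^ 2 ≤ ‖v.fst‖ ^ 2 * (2 * t)⁻¹ := by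
        calc ‖v.snd‖ ^ 2 ≤ (‖v.fst‖ * √‖RKHS.kernel (Ho φ) l l‖) ^ 2 := by gcongr
          _ = ‖v.fst‖ ^ 2 * ‖RKHS.kernel (Ho φ) l l‖ := by
              rw [mul_pow, Real.sq_sqrt (norm_nonneg _)]
          _ ≤ _ := by gcongr
      rw [← div_eq_mul_inv, le_div_iff₀ (by positivity)] at e8
      linarith
    by_contra hne
    have hpos : 0 < ‖v.snd‖ ^ 2 := by positivity
    have := hb ((‖v.fst‖ ^ 2 + 1) / ‖v.snd‖ ^ 2) (by positivity)
    rw [mul_assoc, div_mul_cancel₀ _ hpos.ne'] at this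
    nlinarith [sq_nonneg ‖v.fst‖]
  have h3 : v.fst = 0 := by
    refine RKHS.ext fun l => ?_
    have := h1 l
    rw [h2, add_zero] at this
    simpa using this
  exact WithLp.ofLp_injective 2 (Prod.ext h3 h2)

end Model

/-- The main operator `A_o` of the observable model. -/
noncomputable abbrev mainOpO {U Y : Type*}
    [NormedAddCommGroup U] [InnerProductSpace ℂ U] [CompleteSpace U]
    [NormedAddCommGroup Y] [InnerProductSpace ℂ Y] [CompleteSpace Y]
    (φ : SchurClass U Y) : Ho φ →ₗ.[ℂ] Ho φ :=
  mainOperator (observableModel φ)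

/-- The observation operator `C_o` of the observable model. -/
noncomputable abbrev obsOpO {U Y : Type*}
    [NormedAddCommGroup U] [InnerProductSpace ℂ U] [CompleteSpace U]
    [NormedAddCommGroup Y] [InnerProductSpace ℂ Y] [CompleteSpace Y]
    (φ : SchurClass U Y) : (mainOpO φ).domain →ₗ[ℂ] Y :=
  observationOperator (observableModel φ)

section DeBrangesRovnyak

variable {U Y : Type*}
  [NormedAddCommGroup U] [InnerProductSpace ℂ U] [CompleteSpace U]
  [NormedAddCommGroup Y] [InnerProductSpace ℂ Y] [CompleteSpace Y]

/-! ### Functions in the de Branges-Rovnyak space -/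

/-! Tested on kernel functions, the defining adjoint relation becomes a functional equation: the
model maps `(x, u)` to `(z, y)` exactly when `z(l) + y = l x(l) + φ(l) u` for every `l`
(`mem_graph_observableModel`). Elements of `ℋ_o` decay like `(Re η)^(-1/2)`, so with `u = 0` the
constant `y` is the limit of `η x(η)`. This settles the domain and the action of `A_o` and `C_o`.

The substantial point is that the difference quotients belong to `ℋ_o`. The scattering identity
makes the main operator of the dual node dissipative, with the observation term as exact defect.
Hence `conj α` minus that operator is bounded below, and its range is dense because it contains the
kernel functions at all points other than `α`. Its inverse, and the observation operator composed
with it, extend to bounded operators; their adjoints are the quotients of `x` and of `φ u`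
(`smul_diffQuotO_apply`, `smul_schurQuotO_apply`). The first is then the resolvent of `A_o`.

Accretivity of the adjoint resolvent gives density of `dom A_o`. So `(β - A_o)⁻¹` extends to a
unitary from the rigged space onto `ℋ_o` (`riggedEquivO`), under which every claim about `A_o|` and
`B_o` becomes an identity between functions that can be checked at points `μ ≠ β`. -/

theorem RHP.add_conj_ne_zero (μ l : RHP) : (μ : ℂ) + conj (l : ℂ) ≠ 0 := by
  intro h0
  have := congrArg Complex.re h0
  simp only [Complex.add_re, Complex.conj_re, Complex.zero_re] at this
  linarith [μ.2, l.2]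

theorem RHP.sub_ne_zero_of_ne {α μ : RHP} (h : μ ≠ α) : (α : ℂ) - μ ≠ 0 :=
  sub_ne_zero.mpr fun e => h (Subtype.ext e.symm)

/-- The half-plane has no isolated points, so a continuous function is determined at `α` by its
other values. -/
theorem RHP.neBot_nhdsNE (α : RHP) : (𝓝[≠] α).NeBot := by
  refine mem_closure_iff_nhdsWithin_neBot.mp ?_
  refine mem_closure_of_tendsto (b := atTop)
    (f := fun n : ℕ => (⟨α + ((1 / ((n : ℝ) + 1) : ℝ) : ℂ), ?_⟩ : RHP)) ?_ ?_
  · have := α.2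
    have h1 : 0 < 1 / ((n : ℝ) + 1) := by positivity
    rw [Complex.add_re, Complex.ofReal_re]
    linarith
  · rw [tendsto_subtype_rng]
    have h := (Complex.continuous_ofReal.tendsto 0).comp
      (tendsto_one_div_add_atTop_nhds_zero_nat (𝕜 := ℝ))
    simpa using (tendsto_const_nhds (x := (α : ℂ))).add h
  · refine Eventually.of_forall fun n h => ?_
    have h1 : 0 < 1 / ((n : ℝ) + 1) := by positivity
    have h2 := congrArg Complex.re (congrArg Subtype.val (Set.mem_singleton_iff.mp h))
    rw [Complex.add_re, Complex.ofReal_re] at h2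
    linarith

theorem SchurClass.continuous_halfPlane {U Y : Type*}
    [NormedAddCommGroup U] [InnerProductSpace ℂ U] [NormedAddCommGroup Y] [InnerProductSpace ℂ Y]
    (φ : SchurClass U Y) : Continuous fun μ : RHP => φ μ :=
  continuousOn_iff_continuous_domRestrict.mp φ.differentiableOn.continuousOn

theorem continuous_kernelO (φ : SchurClass U Y) :
    Continuous fun p : RHP × RHP => kernelO φ p.1 p.2 := by
  have h1 : Continuous fun p : RHP × RHP => ((p.1 : ℂ) + conj (p.2 : ℂ))⁻¹ :=
    Continuous.inv₀ (by fun_prop) fun p => RHP.add_conj_ne_zero _ _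
  have h2 : Continuous fun p : RHP × RHP => ContinuousLinearMap.adjoint (φ p.2) :=
    ContinuousLinearMap.adjoint.continuous.comp (φ.continuous_halfPlane.comp continuous_snd)
  exact h1.smul (continuous_const.sub
    ((φ.continuous_halfPlane.comp continuous_fst).clm_comp h2))

/-- By the C*-identity, the squared norm of a difference of two kernel maps is the norm of a
combination of four kernel values, so norm continuity of the kernel suffices. -/
theorem continuous_kerFun_Ho (φ : SchurClass U Y) :
    Continuous fun μ : RHP => RKHS.kerFun (Ho φ) μ := by
  refine continuous_iff_continuousAt.mpr fun ν => ?_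
  rw [ContinuousAt, tendsto_iff_norm_sub_tendsto_zero]
  have key : ∀ μ : RHP, ‖RKHS.kerFun (Ho φ) μ - RKHS.kerFun (Ho φ) ν‖
      = √‖kernelO φ μ μ - kernelO φ ν μ - (kernelO φ μ ν - kernelO φ ν ν)‖ := by
    intro μ
    have h := ContinuousLinearMap.norm_adjoint_comp_self
      (RKHS.kerFun (Ho φ) μ - RKHS.kerFun (Ho φ) ν)
    simp only [map_sub, ContinuousLinearMap.sub_comp, ContinuousLinearMap.comp_sub,
      ← RKHS.kernel_apply, RKHS.OfKernel.kernel_ofKernel] at h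
    rw [← Real.sqrt_mul_self (norm_nonneg (RKHS.kerFun (Ho φ) μ - RKHS.kerFun (Ho φ) ν)), ← h]
  simp only [key]
  have hK := continuous_kernelO φ
  have hc : Continuous fun μ : RHP =>
      √‖kernelO φ μ μ - kernelO φ ν μ - (kernelO φ μ ν - kernelO φ ν ν)‖ :=
    (((hK.comp (continuous_id.prodMk continuous_id)).sub
      (hK.comp (continuous_const.prodMk continuous_id))).sub
      ((hK.comp (continuous_id.prodMk continuous_const)).sub continuous_const)).norm.sqrt
  simpa using hc.tendsto ν

namespace Ho

variable {φ : SchurClass U Y}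

protected theorem continuous (x : Ho φ) : Continuous fun μ : RHP => x μ := by
  have h : Continuous fun μ : RHP => ContinuousLinearMap.adjoint (RKHS.kerFun (Ho φ) μ) :=
    ContinuousLinearMap.adjoint.continuous.comp (continuous_kerFun_Ho φ)
  simpa only [RKHS.adjoint_kerFun] using h.clm_apply continuous_const (g := fun _ => x)

/-- By continuity, a function in `ℋ_o` is determined by its values off one point. -/
theorem ext_of_ne {x y : Ho φ} (α : RHP) (h : ∀ μ : RHP, μ ≠ α → x μ = y μ) : x = y := by
  have := RHP.neBot_nhdsNE α
  refine RKHS.ext fun μ => ?_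
  by_cases hμ : μ = α
  · subst hμ
    refine tendsto_nhds_unique (l := 𝓝[≠] μ) ((x.continuous.tendsto μ).mono_left nhdsWithin_le_nhds)
      (((y.continuous.tendsto μ).mono_left nhdsWithin_le_nhds).congr' ?_)
    filter_upwards [self_mem_nhdsWithin] with ν hν using (h ν hν).symm
  · exact h μ hμ

theorem tendsto_reAtTop (x : Ho φ) : Tendsto (fun η : RHP => x η) reAtTop (𝓝 0) := by
  have hre : Tendsto (fun η : RHP => (η : ℂ).re) reAtTop atTop := tendsto_comap
  have hb : ∀ η : RHP, ‖x η‖ ≤ ‖x‖ * √((η : ℂ).re)⁻¹ := by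
    intro η
    have h1 := RKHS.norm_apply_le x η
    rw [RKHS.OfKernel.kernel_ofKernel] at h1
    refine h1.trans (mul_le_mul_of_nonneg_left (Real.sqrt_le_sqrt ?_) (norm_nonneg _))
    have h2 : (η : ℂ) + conj (η : ℂ) = ((2 * (η : ℂ).re : ℝ) : ℂ) := Complex.add_conj _
    change ‖((η : ℂ) + conj (η : ℂ))⁻¹ • (_ : Y →L[ℂ] Y)‖ ≤ _
    have hη := η.2
    -- The crude bound 2 suffices: it cancels the 2 in `η + conj η = 2 Re η`.
    have h3 : ‖ContinuousLinearMap.id ℂ Y - (φ η) ∘L (ContinuousLinearMap.adjoint (φ η))‖ ≤ 2 := by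
      refine (norm_sub_le _ _).trans ?_
      have h4 := φ.norm_le_one η η.2
      have h5 := (φ η).opNorm_comp_le (ContinuousLinearMap.adjoint (φ η))
      rw [LinearIsometryEquiv.norm_map] at h5
      have h6 := ContinuousLinearMap.norm_id_le (𝕜 := ℂ) (E := Y)
      nlinarith [norm_nonneg (φ η)]
    rw [norm_smul, h2, norm_inv, Complex.norm_real, Real.norm_eq_abs, abs_of_pos (by linarith)]
    calc (2 * (η : ℂ).re)⁻¹ * _ ≤ (2 * (η : ℂ).re)⁻¹ * 2 := by gcongr
      _ = ((η : ℂ).re)⁻¹ := by field_simp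
  refine squeeze_zero_norm hb ?_
  have h := ((tendsto_inv_atTop_zero.comp hre).sqrt).const_mul ‖x‖
  simpa using h

end Ho

/-! ### The graph of the observable model -/

/-- The adjoint condition is closed and conjugate-linear in the element of `dualGraph φ`, so only
the generators need testing. There the reproducing property turns it into an equation of values
paired with an arbitrary `y`. -/
theorem mem_graph_observableModel (φ : SchurClass U Y) (p : WithLp 2 (Ho φ × U))
    (q : WithLp 2 (Ho φ × Y)) :
    (p, q) ∈ (observableModel φ).graph ↔
      ∀ l : RHP, q.fst l + q.snd = (l : ℂ) • p.fst l + φ l p.snd := by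
  rw [observableModel, LinearPMap.adjoint_graph_eq_graph_adjoint (dense_dualNode_domain φ),
    graph_dualNode, Submodule.mem_adjoint_iff]
  constructor
  · intro h l
    refine ext_inner_left ℂ fun y => ?_
    have h1 := h _ _ (mem_dualGraph φ l y)
    simp only [WithLp.prod_inner_apply, inner_smul_left, Complex.conj_conj, RKHS.kerFun_inner,
      ContinuousLinearMap.adjoint_inner_left] at h1
    rw [inner_add_right, inner_add_right, inner_smul_right]
    exact (sub_eq_zero.mp h1).symm
  · intro h a b hab
    have c1 : Continuous fun r : WithLp 2 (Ho φ × Y) × WithLp 2 (Ho φ × U) => r.1.fst := by fun_prop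
    have c2 : Continuous fun r : WithLp 2 (Ho φ × Y) × WithLp 2 (Ho φ × U) => r.1.snd := by fun_prop
    have c3 : Continuous fun r : WithLp 2 (Ho φ × Y) × WithLp 2 (Ho φ × U) => r.2.fst := by fun_prop
    have c4 : Continuous fun r : WithLp 2 (Ho φ × Y) × WithLp 2 (Ho φ × U) => r.2.snd := by fun_prop
    have hcl : IsClosed {r : WithLp 2 (Ho φ × Y) × WithLp 2 (Ho φ × U) |
        inner ℂ r.2.fst p.fst + inner ℂ r.2.snd p.snd
          - (inner ℂ r.1.fst q.fst + inner ℂ r.1.snd q.snd) = 0} :=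
      isClosed_eq (((c3.inner continuous_const).add (c4.inner continuous_const)).sub
        ((c1.inner continuous_const).add (c2.inner continuous_const))) continuous_const
    simp only [WithLp.prod_inner_apply]
    rw [dualGraph, ← SetLike.mem_coe, Submodule.topologicalClosure_coe] at hab
    suffices h0 : (a, b) ∈ {r : WithLp 2 (Ho φ × Y) × WithLp 2 (Ho φ × U) |
        inner ℂ r.2.fst p.fst + inner ℂ r.2.snd p.snd
          - (inner ℂ r.1.fst q.fst + inner ℂ r.1.snd q.snd) = 0} from h0
    refine closure_minimal (fun r hr => ?_) hcl hab
    simp only [Set.mem_ofPred_eq]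
    refine Submodule.span_induction ?_ ?_ ?_ ?_ hr
    · rintro _ ⟨l, y, rfl⟩
      change inner ℂ (conj (l : ℂ) • RKHS.kerFun (Ho φ) l y) p.fst
        + inner ℂ ((φ l).adjoint y) p.snd
        - (inner ℂ (RKHS.kerFun (Ho φ) l y) q.fst + inner ℂ y q.snd) = 0
      simp only [inner_smul_left, Complex.conj_conj, RKHS.kerFun_inner,
        ContinuousLinearMap.adjoint_inner_left]
      have h1 := congrArg (inner ℂ y) (h l)
      rw [inner_add_right, inner_add_right, inner_smul_right] at h1
      exact sub_eq_zero.mpr h1.symm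
    · simp
    · intro a b _ _ ha hb
      simp only [Prod.fst_add, Prod.snd_add, WithLp.add_fst, WithLp.add_snd, inner_add_left]
      linear_combination ha + hb
    · intro c a _ ha
      simp only [Prod.smul_fst, Prod.smul_snd, WithLp.smul_fst, WithLp.smul_snd, inner_smul_left]
      linear_combination conj c * ha

theorem mem_domain_observableModel_iff (φ : SchurClass U Y) (p : WithLp 2 (Ho φ × U)) :
    p ∈ (observableModel φ).domain ↔
      ∃ (z : Ho φ) (y : Y), ∀ l : RHP, z l + y = (l : ℂ) • p.fst l + φ l p.snd := by
  rw [LinearPMap.mem_domain_iff]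
  constructor
  · rintro ⟨q, hq⟩
    exact ⟨q.fst, q.snd, (mem_graph_observableModel φ p q).mp hq⟩
  · rintro ⟨z, y, h⟩
    exact ⟨WithLp.toLp 2 (z, y), (mem_graph_observableModel φ p _).mpr h⟩

theorem observableModel_apply (φ : SchurClass U Y) (w : (observableModel φ).domain) (l : RHP) :
    (observableModel φ w).fst l + (observableModel φ w).snd
      = (l : ℂ) • (w : WithLp 2 (Ho φ × U)).fst l + φ l (w : WithLp 2 (Ho φ × U)).snd :=
  (mem_graph_observableModel φ _ _).mp ((observableModel φ).mem_graph w) l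

/-- A solution of the functional equation is a graph point, and graphs are single-valued. Behind
this is the density of the dual domain, that is, the absence of nonzero constants in `ℋ_o`. -/
theorem observableModel_eq_of_forall (φ : SchurClass U Y) (w : (observableModel φ).domain)
    (q : WithLp 2 (Ho φ × Y))
    (h : ∀ l : RHP, q.fst l + q.snd
      = (l : ℂ) • (w : WithLp 2 (Ho φ × U)).fst l + φ l (w : WithLp 2 (Ho φ × U)).snd) :
    observableModel φ w = q := by
  obtain ⟨v, hv, hq⟩ := (LinearPMap.mem_graph_iff _).mp ((mem_graph_observableModel φ w q).mpr h)
  obtain rfl : v = w := Subtype.ext hv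
  exact hq

theorem mem_domain_mainOpO_iff (φ : SchurClass U Y) (x : Ho φ) :
    x ∈ (mainOpO φ).domain ↔
      ∃ y : Y, ∃ z : Ho φ, ∀ μ : RHP, z μ = (μ : ℂ) • x μ - y := by
  refine (mem_domain_observableModel_iff φ (WithLp.toLp 2 (x, (0 : U)))).trans ?_
  rw [exists_comm]
  simp [eq_sub_iff_add_eq]

theorem mainOpO_apply (φ : SchurClass U Y) (x : (mainOpO φ).domain) (μ : RHP) :
    mainOpO φ x μ = (μ : ℂ) • (x : Ho φ) μ - obsOpO φ x := by
  have h := observableModel_apply φ ⟨WithLp.toLp 2 ((x : Ho φ), (0 : U)), x.2⟩ μ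
  replace h : (mainOpO φ x) μ + obsOpO φ x = (μ : ℂ) • (x : Ho φ) μ + φ μ 0 := h
  rw [map_zero, add_zero] at h
  exact eq_sub_of_add_eq h

/-- The values of `A_o` and `C_o` are determined by `(A_o x) μ = μ x(μ) - C_o x`. -/
theorem mainOpO_eq_and_obsOpO_eq (φ : SchurClass U Y) (x : (mainOpO φ).domain) {z : Ho φ} {y : Y}
    (h : ∀ μ : RHP, z μ = (μ : ℂ) • (x : Ho φ) μ - y) : mainOpO φ x = z ∧ obsOpO φ x = y := by
  have h1 := observableModel_eq_of_forall φ ⟨WithLp.toLp 2 ((x : Ho φ), (0 : U)), x.2⟩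
    (WithLp.toLp 2 (z, y)) fun l => by simp [h]
  exact ⟨congrArg WithLp.fst h1, congrArg WithLp.snd h1⟩

theorem tendsto_smul_apply_reAtTop (φ : SchurClass U Y) (x : (mainOpO φ).domain) :
    Tendsto (fun η : RHP => (η : ℂ) • (x : Ho φ) η) reAtTop (𝓝 (obsOpO φ x)) := by
  have h := (mainOpO φ x).tendsto_reAtTop.add_const (obsOpO φ x)
  simpa [mainOpO_apply] using h

/-- Membership of `(x, z)` in the graph says that `μ x(μ) - z(μ)` does not depend on `μ`. This is a
family of closed conditions, since evaluations are continuous. -/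
theorem isClosed_mainOpO (φ : SchurClass U Y) : (mainOpO φ).IsClosed := by
  have h : ((mainOpO φ).graph : Set (Ho φ × Ho φ)) =
      ⋂ (μ : RHP) (ν : RHP), {p | (μ : ℂ) • p.1 μ - p.2 μ = (ν : ℂ) • p.1 ν - p.2 ν} := by
    ext p
    simp only [SetLike.mem_coe, Set.mem_iInter, Set.mem_ofPred_eq]
    constructor
    · intro hp μ ν
      obtain ⟨x, hx, hz⟩ := (LinearPMap.mem_graph_iff _).mp hp
      rw [← hx, ← hz, mainOpO_apply, mainOpO_apply]
      abel
    · intro hp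
      -- The constant value is read off at the point `1`.
      have hf : ∀ μ : RHP, p.2 μ = (μ : ℂ) • p.1 μ -
          ((1 : ℂ) • p.1 ⟨1, by simp⟩ - p.2 ⟨1, by simp⟩) := fun μ => by
        rw [← hp μ ⟨1, by simp⟩, sub_sub_cancel]
      have hd := (mem_domain_mainOpO_iff φ p.1).mpr ⟨_, p.2, hf⟩
      exact (LinearPMap.mem_graph_iff _).mpr
        ⟨⟨p.1, hd⟩, rfl, (mainOpO_eq_and_obsOpO_eq φ ⟨p.1, hd⟩ hf).1⟩
  have ev : ∀ μ : RHP, Continuous fun x : Ho φ => x μ := RKHS.continuous_eval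
  rw [LinearPMap.IsClosed, h]
  refine isClosed_iInter fun μ => isClosed_iInter fun ν => isClosed_eq ?_ ?_
  · exact (((ev μ).comp continuous_fst).const_smul _).sub ((ev μ).comp continuous_snd)
  · exact (((ev ν).comp continuous_fst).const_smul _).sub ((ev ν).comp continuous_snd)

/-! ### The main operator of the dual node and its resolvent -/

/-- The main operator of `[A&B; C&D]_o^*`. -/
noncomputable abbrev dualMainOp (φ : SchurClass U Y) : Ho φ →ₗ.[ℂ] Ho φ :=
  mainOperator (dualNode φ)

/-- The observation operator of `[A&B; C&D]_o^*`. -/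
noncomputable abbrev dualObsOp (φ : SchurClass U Y) : (dualMainOp φ).domain →ₗ[ℂ] U :=
  observationOperator (dualNode φ)

/-- Dissipativity of the dual main operator: this is the scattering identity of an element paired
with itself. -/
theorem two_mul_re_inner_of_mem_dualGraph (φ : SchurClass U Y)
    {p : WithLp 2 (Ho φ × Y) × WithLp 2 (Ho φ × U)} (hp : p ∈ dualGraph φ) (h0 : p.1.snd = 0) :
    2 * (inner ℂ p.2.fst p.1.fst).re = -‖p.2.snd‖ ^ 2 := by
  have h := dualGraph_isometric φ hp hp
  have e : inner ℂ p.2.snd p.2.snd = ((‖p.2.snd‖ ^ 2 : ℝ) : ℂ) := by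
    rw [inner_self_eq_norm_sq_to_K]
    norm_cast
  rw [h0, inner_zero_left, ← inner_conj_symm p.1.fst p.2.fst, Complex.add_conj, e, zero_sub,
    sub_neg_eq_add, ← Complex.ofReal_add, Complex.ofReal_eq_zero] at h
  linarith

theorem two_mul_re_inner_dualMainOp (φ : SchurClass U Y) (x : (dualMainOp φ).domain) :
    2 * (inner ℂ (dualMainOp φ x) (x : Ho φ)).re = -‖dualObsOp φ x‖ ^ 2 := by
  refine two_mul_re_inner_of_mem_dualGraph φ (p := (WithLp.toLp 2 ((x : Ho φ), (0 : Y)),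
    dualNode φ ⟨WithLp.toLp 2 ((x : Ho φ), (0 : Y)), x.2⟩)) ?_ rfl
  rw [← graph_dualNode]
  exact (dualNode φ).mem_graph ⟨WithLp.toLp 2 ((x : Ho φ), (0 : Y)), x.2⟩

/-- Two generators with the same `y` are subtracted, so that the `Y`-component of the input cancels.
-/
theorem exists_mem_dualMainOp_domain (φ : SchurClass U Y) (α l : RHP) (y : Y) :
    ∃ x : (dualMainOp φ).domain,
      (x : Ho φ) = RKHS.kerFun (Ho φ) l y - RKHS.kerFun (Ho φ) α y ∧
      dualMainOp φ x
        = conj (l : ℂ) • RKHS.kerFun (Ho φ) l y - conj (α : ℂ) • RKHS.kerFun (Ho φ) α y ∧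
      dualObsOp φ x = (φ l).adjoint y - (φ α).adjoint y := by
  have h := (dualGraph φ).sub_mem (mem_dualGraph φ l y) (mem_dualGraph φ α y)
  rw [← graph_dualNode, LinearPMap.mem_graph_iff] at h
  obtain ⟨v, hv, hw⟩ := h
  have hv' : (v : WithLp 2 (Ho φ × Y)) =
      WithLp.toLp 2 (RKHS.kerFun (Ho φ) l y - RKHS.kerFun (Ho φ) α y, (0 : Y)) := by
    rw [hv, Prod.fst_sub, ← WithLp.toLp_sub, Prod.mk_sub_mk, sub_self]
  have hmem : RKHS.kerFun (Ho φ) l y - RKHS.kerFun (Ho φ) α y ∈ (dualMainOp φ).domain := by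
    change WithLp.toLp 2 (_, (0 : Y)) ∈ (dualNode φ).domain
    rw [← hv']
    exact v.2
  have hval : dualNode φ ⟨_, hmem⟩ = _ := (congrArg (dualNode φ) (Subtype.ext hv'.symm)).trans hw
  exact ⟨⟨_, hmem⟩, rfl, congrArg WithLp.fst hval, congrArg WithLp.snd hval⟩

/-- This one identity yields two bounds by the Cauchy-Schwarz inequality: one for the inverse of the
shifted operator, one for the observation operator composed with that inverse. -/
theorem shiftOp_dualMainOp_estimate (φ : SchurClass U Y) (α : RHP) (x : (dualMainOp φ).domain) :
    2 * (α : ℂ).re * ‖(x : Ho φ)‖ ^ 2 + ‖dualObsOp φ x‖ ^ 2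
      = 2 * (inner ℂ (shiftOp (dualMainOp φ) (conj (α : ℂ)) x) (x : Ho φ)).re := by
  have h := two_mul_re_inner_dualMainOp φ x
  have e : shiftOp (dualMainOp φ) (conj (α : ℂ)) x
      = conj (α : ℂ) • (x : Ho φ) - dualMainOp φ x := rfl
  have e2 : inner ℂ (x : Ho φ) (x : Ho φ) = ((‖(x : Ho φ)‖ ^ 2 : ℝ) : ℂ) := by
    rw [inner_self_eq_norm_sq_to_K]
    norm_cast
  rw [e, inner_sub_left, inner_smul_left, Complex.conj_conj, e2,
    Complex.sub_re, Complex.re_mul_ofReal]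
  linarith

theorem norm_le_norm_shiftOp_dualMainOp (φ : SchurClass U Y) (α : RHP)
    (x : (dualMainOp φ).domain) :
    ‖(x : Ho φ)‖ ≤ ((α : ℂ).re)⁻¹ * ‖shiftOp (dualMainOp φ) (conj (α : ℂ)) x‖ := by
  have h := shiftOp_dualMainOp_estimate φ α x
  have hα := α.2
  have hcs : (inner ℂ (shiftOp (dualMainOp φ) (conj (α : ℂ)) x) (x : Ho φ)).re ≤ _ :=
    re_inner_le_norm (𝕜 := ℂ) _ _
  rw [inv_mul_eq_div, le_div_iff₀ hα]
  rcases (norm_nonneg (x : Ho φ)).eq_or_lt with h0 | h0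
  · rw [← h0, zero_mul]
    exact norm_nonneg _
  · refine le_of_mul_le_mul_right ?_ h0
    nlinarith [sq_nonneg ‖dualObsOp φ x‖]

theorem norm_dualObsOp_le (φ : SchurClass U Y) (α : RHP) (x : (dualMainOp φ).domain) :
    ‖dualObsOp φ x‖ ≤
      √(2 * ((α : ℂ).re)⁻¹) * ‖shiftOp (dualMainOp φ) (conj (α : ℂ)) x‖ := by
  have h := shiftOp_dualMainOp_estimate φ α x
  have h1 := norm_le_norm_shiftOp_dualMainOp φ α x
  have hα := α.2
  have hcs : (inner ℂ (shiftOp (dualMainOp φ) (conj (α : ℂ)) x) (x : Ho φ)).re ≤ _ :=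
    re_inner_le_norm (𝕜 := ℂ) _ _
  refine Real.le_sqrt_of_sq_le ?_ |>.trans_eq (b := √(2 * ((α : ℂ).re)⁻¹ *
    ‖shiftOp (dualMainOp φ) (conj (α : ℂ)) x‖ ^ 2)) ?_
  · have h2 := mul_le_mul_of_nonneg_left h1
      (norm_nonneg (shiftOp (dualMainOp φ) (conj (α : ℂ)) x))
    have h3 : 0 ≤ 2 * (α : ℂ).re * ‖(x : Ho φ)‖ ^ 2 := by positivity
    linarith
  · rw [Real.sqrt_mul (by positivity), Real.sqrt_sq (norm_nonneg _)]

/-- Applied to the difference of the kernel functions at `l` and `α`, the shifted operator cancels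
the one at `α` and leaves a nonzero multiple of the one at `l ≠ α`. A vector orthogonal to the range
thus vanishes off `α`, hence everywhere by continuity. -/
theorem denseRange_shiftOp_dualMainOp (φ : SchurClass U Y) (α : RHP) :
    DenseRange (shiftOp (dualMainOp φ) (conj (α : ℂ))) := by
  change Dense (Set.range _)
  rw [← LinearMap.coe_range, Submodule.dense_iff_topologicalClosure_eq_top,
    Submodule.topologicalClosure_eq_top_iff, Submodule.eq_bot_iff]
  intro v hv
  refine Ho.ext_of_ne α fun l hl => ext_inner_left ℂ fun y => ?_
  obtain ⟨x, hx, hAx, -⟩ := exists_mem_dualMainOp_domain φ α l y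
  have h := (Submodule.mem_orthogonal _ _).mp hv _ (LinearMap.mem_range_self _ x)
  have e : shiftOp (dualMainOp φ) (conj (α : ℂ)) x
      = conj ((α : ℂ) - l) • RKHS.kerFun (Ho φ) l y := by
    change conj (α : ℂ) • (x : Ho φ) - dualMainOp φ x = _
    rw [hx, hAx, map_sub, sub_smul, smul_sub]
    abel
  rw [e, inner_smul_left, Complex.conj_conj, RKHS.kerFun_inner, mul_eq_zero] at h
  simpa using h.resolve_left (RHP.sub_ne_zero_of_ne hl)

/-- The bounded inverse of `conj α - A_o^*`. -/
noncomputable def dualResolvent (φ : SchurClass U Y) (α : RHP) : Ho φ →L[ℂ] Ho φ :=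
  (dualMainOp φ).domain.subtype.extendOfNorm (shiftOp (dualMainOp φ) (conj (α : ℂ)))

/-- The observation operator of the dual node composed with `(conj α - A_o^*)⁻¹`. -/
noncomputable def dualObsResolvent (φ : SchurClass U Y) (α : RHP) : Ho φ →L[ℂ] U :=
  (dualObsOp φ).extendOfNorm (shiftOp (dualMainOp φ) (conj (α : ℂ)))

theorem dualResolvent_shiftOp (φ : SchurClass U Y) (α : RHP) (x : (dualMainOp φ).domain) :
    dualResolvent φ α (shiftOp (dualMainOp φ) (conj (α : ℂ)) x) = x :=
  LinearMap.extendOfNorm_eq (denseRange_shiftOp_dualMainOp φ α)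
    ⟨_, norm_le_norm_shiftOp_dualMainOp φ α⟩ x

theorem dualObsResolvent_shiftOp (φ : SchurClass U Y) (α : RHP) (x : (dualMainOp φ).domain) :
    dualObsResolvent φ α (shiftOp (dualMainOp φ) (conj (α : ℂ)) x) = dualObsOp φ x :=
  LinearMap.extendOfNorm_eq (denseRange_shiftOp_dualMainOp φ α)
    ⟨_, norm_dualObsOp_le φ α⟩ x

/-- The factor is kept on the left instead of being inverted, so that `l = α` is included. -/
theorem dualResolvent_kerFun (φ : SchurClass U Y) (α l : RHP) (y : Y) :
    conj ((α : ℂ) - l) • dualResolvent φ α (RKHS.kerFun (Ho φ) l y)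
        = RKHS.kerFun (Ho φ) l y - RKHS.kerFun (Ho φ) α y ∧
      conj ((α : ℂ) - l) • dualObsResolvent φ α (RKHS.kerFun (Ho φ) l y)
        = (φ l).adjoint y - (φ α).adjoint y := by
  obtain ⟨x, hx, hAx, hCx⟩ := exists_mem_dualMainOp_domain φ α l y
  have e : shiftOp (dualMainOp φ) (conj (α : ℂ)) x
      = conj ((α : ℂ) - l) • RKHS.kerFun (Ho φ) l y := by
    change conj (α : ℂ) • (x : Ho φ) - dualMainOp φ x = _
    rw [hx, hAx, map_sub, sub_smul, smul_sub]
    abel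
  rw [← (dualResolvent φ α).map_smul, ← (dualObsResolvent φ α).map_smul, ← e,
    dualResolvent_shiftOp, dualObsResolvent_shiftOp]
  exact ⟨hx, hCx⟩

theorem re_inner_dualResolvent_nonneg (φ : SchurClass U Y) (α : RHP) (x : Ho φ) :
    0 ≤ (inner ℂ x (dualResolvent φ α x)).re := by
  refine (denseRange_shiftOp_dualMainOp φ α).induction_on
    (p := fun x => 0 ≤ (inner ℂ x (dualResolvent φ α x)).re) x ?_ fun v => ?_
  · exact isClosed_le continuous_const
      (Complex.continuous_re.comp (continuous_id.inner (dualResolvent φ α).continuous))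
  · have h := shiftOp_dualMainOp_estimate φ α v
    have hα := α.2
    have h3 : 0 ≤ 2 * (α : ℂ).re * ‖(v : Ho φ)‖ ^ 2 := by positivity
    rw [dualResolvent_shiftOp]
    linarith [sq_nonneg ‖dualObsOp φ v‖]

/-! ### Difference quotients in the de Branges-Rovnyak space -/

/-- The difference quotient `x ↦ (x - x α) / (α - ·)` as a bounded operator on `ℋ_o`. -/
noncomputable def diffQuotO (φ : SchurClass U Y) (α : RHP) : Ho φ →L[ℂ] Ho φ :=
  (dualResolvent φ α).adjoint

/-- The difference quotient `u ↦ (φ - φ α) u / (α - ·)` as a bounded operator into `ℋ_o`. -/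
noncomputable def schurQuotO (φ : SchurClass U Y) (α : RHP) : U →L[ℂ] Ho φ :=
  (dualObsResolvent φ α).adjoint

/-- Pairing with `y` moves the operator onto the kernel function at `μ`, where
`dualResolvent_kerFun` applies. This is where membership of the quotient in `ℋ_o` is obtained. -/
theorem smul_diffQuotO_apply (φ : SchurClass U Y) (α : RHP) (x : Ho φ) (μ : RHP) :
    ((α : ℂ) - μ) • diffQuotO φ α x μ = x μ - x α := by
  refine ext_inner_left ℂ fun y => ?_
  rw [inner_smul_right, ← RKHS.kerFun_inner, diffQuotO, ContinuousLinearMap.adjoint_inner_right,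
    ← Complex.conj_conj ((α : ℂ) - μ), ← inner_smul_left, (dualResolvent_kerFun φ α μ y).1,
    inner_sub_left, RKHS.kerFun_inner, RKHS.kerFun_inner, inner_sub_right]

theorem smul_schurQuotO_apply (φ : SchurClass U Y) (α : RHP) (u : U) (μ : RHP) :
    ((α : ℂ) - μ) • schurQuotO φ α u μ = φ μ u - φ α u := by
  refine ext_inner_left ℂ fun y => ?_
  rw [inner_smul_right, ← RKHS.kerFun_inner, schurQuotO, ContinuousLinearMap.adjoint_inner_right,
    ← Complex.conj_conj ((α : ℂ) - μ), ← inner_smul_left, (dualResolvent_kerFun φ α μ y).2,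
    inner_sub_left, ContinuousLinearMap.adjoint_inner_left,
    ContinuousLinearMap.adjoint_inner_left, inner_sub_right]

/-- Continuity of `g` supplies the limit at `α`, so no differentiability of `f` is needed. -/
theorem Ho.isDiffQuot {φ : SchurClass U Y} {f : RHP → Y} {α : RHP} {g : Ho φ}
    (h : ∀ μ : RHP, ((α : ℂ) - μ) • g μ = f μ - f α) : IsDiffQuot f α (fun μ => g μ) := by
  have h' : ∀ μ : RHP, μ ≠ α → g μ = ((α : ℂ) - μ)⁻¹ • (f μ - f α) := fun μ hμ => by
    rw [← h μ, inv_smul_smul₀ (RHP.sub_ne_zero_of_ne hμ)]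
  refine ⟨h', ((g.continuous.tendsto α).mono_left nhdsWithin_le_nhds).congr' ?_⟩
  filter_upwards [self_mem_nhdsWithin] with μ hμ using h' μ hμ

/-! ### The resolvent of the main operator -/

/-- The quotient identity in the form required by the description of `dom A_o`, with constant
`x(α)`; the domain, `A_o` and `C_o` can be read off from it. -/
theorem diffQuotO_apply_eq (φ : SchurClass U Y) (α : RHP) (x : Ho φ) (μ : RHP) :
    ((α : ℂ) • diffQuotO φ α x - x) μ = (μ : ℂ) • diffQuotO φ α x μ - x α := by
  have h := smul_diffQuotO_apply φ α x μ
  rw [sub_smul] at h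
  rw [RKHS.coe_sub, RKHS.coe_smul, Pi.sub_apply, Pi.smul_apply, sub_eq_sub_iff_sub_eq_sub]
  exact h

theorem diffQuotO_mem_domain (φ : SchurClass U Y) (α : RHP) (x : Ho φ) :
    diffQuotO φ α x ∈ (mainOpO φ).domain :=
  (mem_domain_mainOpO_iff φ _).mpr ⟨_, _, diffQuotO_apply_eq φ α x⟩

theorem mainOpO_diffQuotO (φ : SchurClass U Y) (α : RHP) (x : Ho φ) :
    mainOpO φ ⟨diffQuotO φ α x, diffQuotO_mem_domain φ α x⟩ = (α : ℂ) • diffQuotO φ α x - x ∧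
      obsOpO φ ⟨diffQuotO φ α x, diffQuotO_mem_domain φ α x⟩ = x α :=
  mainOpO_eq_and_obsOpO_eq φ _ (diffQuotO_apply_eq φ α x)

theorem bijective_shiftOp_mainOpO (φ : SchurClass U Y) (α : RHP) :
    Function.Bijective (shiftOp (mainOpO φ) α) := by
  constructor
  · refine (injective_iff_map_eq_zero _).mpr fun x hx => ?_
    have h : ∀ μ : RHP, ((α : ℂ) - μ) • (x : Ho φ) μ + obsOpO φ x = 0 := by
      intro μ
      have hμ : ((α : ℂ) • (x : Ho φ) - mainOpO φ x) μ = 0 := by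
        change (shiftOp (mainOpO φ) α x) μ = 0
        rw [hx, RKHS.coe_zero, Pi.zero_apply]
      rw [RKHS.coe_sub, RKHS.coe_smul, Pi.sub_apply, Pi.smul_apply, mainOpO_apply] at hμ
      rw [← hμ, sub_smul]
      abel
    -- At `μ = α` only the constant survives.
    have hC : obsOpO φ x = 0 := by simpa using h α
    refine Subtype.ext (Ho.ext_of_ne α fun μ hμ => ?_)
    have h1 := h μ
    rw [hC, add_zero, smul_eq_zero] at h1
    simpa using h1.resolve_left (RHP.sub_ne_zero_of_ne hμ)
  · intro x
    refine ⟨⟨diffQuotO φ α x, diffQuotO_mem_domain φ α x⟩, ?_⟩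
    change (α : ℂ) • diffQuotO φ α x - mainOpO φ ⟨diffQuotO φ α x, _⟩ = x
    rw [(mainOpO_diffQuotO φ α x).1, sub_sub_cancel]

theorem resolventOp_mainOpO (φ : SchurClass U Y) (α : RHP) (x : Ho φ) :
    resolventOp (mainOpO φ) α x = ⟨diffQuotO φ α x, diffQuotO_mem_domain φ α x⟩ := by
  rw [resolventOp, dif_pos (bijective_shiftOp_mainOpO φ α)]
  refine (LinearEquiv.symm_apply_eq _).mpr ?_
  change x = (α : ℂ) • diffQuotO φ α x - mainOpO φ ⟨diffQuotO φ α x, _⟩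
  rw [(mainOpO_diffQuotO φ α x).1, sub_sub_cancel]

theorem diffQuotO_mainOpO (φ : SchurClass U Y) (α : RHP) (x : (mainOpO φ).domain) :
    diffQuotO φ α (mainOpO φ x) = (α : ℂ) • diffQuotO φ α x - x := by
  refine Ho.ext_of_ne α fun μ hμ => smul_right_injective Y (RHP.sub_ne_zero_of_ne hμ) ?_
  have h1 := smul_diffQuotO_apply φ α (mainOpO φ x) μ
  have h2 := smul_diffQuotO_apply φ α (x : Ho φ) μ
  simp only [RKHS.coe_sub, RKHS.coe_smul, Pi.sub_apply, Pi.smul_apply]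
  rw [h1, smul_sub, smul_comm, h2, mainOpO_apply, mainOpO_apply]
  module

theorem diffQuotO_sub_diffQuotO (φ : SchurClass U Y) (α β : RHP) (x : Ho φ) :
    diffQuotO φ β x - diffQuotO φ α x
      = ((α : ℂ) - β) • diffQuotO φ β (diffQuotO φ α x) := by
  have h := diffQuotO_mainOpO φ β ⟨diffQuotO φ α x, diffQuotO_mem_domain φ α x⟩
  rw [(mainOpO_diffQuotO φ α x).1, map_sub, map_smul] at h
  rw [sub_smul]
  exact (sub_eq_sub_iff_sub_eq_sub.mp h).symm

/-- The domain of `A_o` is dense, since its resolvent has an accretive adjoint. -/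
theorem dense_domain_mainOpO (φ : SchurClass U Y) :
    Dense ((mainOpO φ).domain : Set (Ho φ)) := by
  rw [Submodule.dense_iff_topologicalClosure_eq_top, Submodule.topologicalClosure_eq_top_iff,
    Submodule.eq_bot_iff]
  intro y hy
  set α : RHP := ⟨1, by simp⟩
  -- Orthogonality to the range of the resolvent, which lies in the domain, puts `y` in the kernel
  -- of its adjoint.
  have hP : dualResolvent φ α y = 0 := ext_inner_left ℂ fun v => by
    rw [← ContinuousLinearMap.adjoint_inner_left, inner_zero_right]
    exact (Submodule.mem_orthogonal _ _).mp hy _ (diffQuotO_mem_domain φ α v)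
  have hR : diffQuotO φ α y = 0 := by
    set w := diffQuotO φ α y with hw
    have hc : inner ℂ y (dualResolvent φ α w) = ((‖w‖ ^ 2 : ℝ) : ℂ) := by
      rw [← ContinuousLinearMap.adjoint_inner_left]
      change inner ℂ w w = _
      rw [inner_self_eq_norm_sq_to_K]
      norm_cast
    -- Accretivity is applied to `w - t y`. As the adjoint resolvent kills `y`, the form is affine
    -- in `t` with slope `-‖w‖²`; being nonnegative for all real `t`, it forces `w = 0`.
    have h : ∀ t : ℝ, t * ‖w‖ ^ 2 ≤ (inner ℂ w (dualResolvent φ α w)).re := by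
      intro t
      have h1 := re_inner_dualResolvent_nonneg φ α (w - (t : ℂ) • y)
      rw [map_sub, map_smul, hP, smul_zero, sub_zero, inner_sub_left, inner_smul_left, hc,
        Complex.conj_ofReal, Complex.sub_re, ← Complex.ofReal_mul, Complex.ofReal_re] at h1
      linarith
    by_contra hne
    have hpos : 0 < ‖w‖ ^ 2 := by positivity
    have h2 := h (((inner ℂ w (dualResolvent φ α w)).re + 1) / ‖w‖ ^ 2)
    rw [div_mul_cancel₀ _ hpos.ne'] at h2
    linarith
  -- In `A_o R y = α R y - y`, with `R` the resolvent at `α`, vanishing of `R y` leaves `y = 0`.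
  have h3 := (mainOpO_diffQuotO φ α y).1
  have h4 : (⟨diffQuotO φ α y, diffQuotO_mem_domain φ α y⟩ : (mainOpO φ).domain) = 0 :=
    Subtype.ext hR
  rw [h4, LinearPMap.map_zero, hR, smul_zero, zero_sub] at h3
  exact neg_eq_zero.mp h3.symm

/-! ### The rigged space and the control operator -/

theorem weakNormed_res_mainOpO (φ : SchurClass U Y) (β : RHP) (x : Ho φ) :
    WeakNormed.res (mainOpO φ) β x = diffQuotO φ β x :=
  congrArg Subtype.val (resolventOp_mainOpO φ β x)

theorem denseRange_weakNormed_res (φ : SchurClass U Y) (β : RHP) :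
    DenseRange (WeakNormed.res (mainOpO φ) β) := by
  refine (dense_domain_mainOpO φ).mono fun x hx => ?_
  obtain ⟨z, hz⟩ : ∃ z : Ho φ, diffQuotO φ β z = x :=
    ⟨(β : ℂ) • x - mainOpO φ ⟨x, hx⟩, by
      rw [map_sub, map_smul, diffQuotO_mainOpO, sub_sub_cancel]⟩
  exact ⟨z, (weakNormed_res_mainOpO φ β z).trans hz⟩

/-- The unitary extension of `(β - A_o)⁻¹` to the rigged space. -/
noncomputable def riggedEquivO (φ : SchurClass U Y) (β : RHP) :
    RiggedSpace (mainOpO φ) β ≃ₗᵢ[ℂ] Ho φ :=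
  -- The inclusion into the completion and `WeakNormed.res` both have dense range and give each
  -- vector the same norm, so the identity extends to a unitary.
  (LinearEquiv.refl ℂ (WeakNormed (mainOpO φ) β)).extendOfIsometry
    (UniformSpace.Completion.toComplL (𝕜 := ℂ) (E := WeakNormed (mainOpO φ) β)).toLinearMap
    (WeakNormed.res (mainOpO φ) β)
    UniformSpace.Completion.denseRange_coe (denseRange_weakNormed_res φ β)
    fun x => (UniformSpace.Completion.norm_coe x).symm

theorem riggedEquivO_riggedIncl (φ : SchurClass U Y) (β : RHP) (x : Ho φ) :
    riggedEquivO φ β (riggedIncl (mainOpO φ) β x) = diffQuotO φ β x := by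
  refine Eq.trans ?_ (weakNormed_res_mainOpO φ β x)
  exact LinearEquiv.extendOfIsometry_eq _ _ _ _ _ _ x

/-- The continuous extension of `A_o` to `ℋ_o`, with values in the rigged space. -/
noncomputable def riggedMainOpO (φ : SchurClass U Y) (β : RHP) :
    Ho φ →L[ℂ] RiggedSpace (mainOpO φ) β :=
  -- On `dom A_o`, `(β - A_o)⁻¹ A_o = β (β - A_o)⁻¹ - 1`, and the right side is bounded on all of
  -- `ℋ_o`.
  ((riggedEquivO φ β).symm : Ho φ →L[ℂ] RiggedSpace (mainOpO φ) β) ∘L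
    ((β : ℂ) • diffQuotO φ β - ContinuousLinearMap.id ℂ (Ho φ))

theorem riggedEquivO_riggedMainOpO (φ : SchurClass U Y) (β : RHP) (x : Ho φ) :
    riggedEquivO φ β (riggedMainOpO φ β x) = (β : ℂ) • diffQuotO φ β x - x :=
  (riggedEquivO φ β).apply_symm_apply _

theorem isRiggedExtension_iff (φ : SchurClass U Y) (β : RHP)
    (T : Ho φ →L[ℂ] RiggedSpace (mainOpO φ) β) :
    IsRiggedExtension (mainOpO φ) β T ↔ T = riggedMainOpO φ β := by
  have h0 : ∀ x : (mainOpO φ).domain,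
      riggedMainOpO φ β x = riggedIncl (mainOpO φ) β (mainOpO φ x) := fun x =>
    (riggedEquivO φ β).injective <| by
      rw [riggedEquivO_riggedMainOpO, riggedEquivO_riggedIncl, diffQuotO_mainOpO]
  constructor
  · intro h
    refine ContinuousLinearMap.ext fun x => congrFun
      (T.continuous.ext_on (dense_domain_mainOpO φ) (riggedMainOpO φ β).continuous fun v hv => ?_) x
    exact (h ⟨v, hv⟩).trans (h0 ⟨v, hv⟩).symm
  · rintro rfl
    exact h0

/-- The control operator of the observable model. -/
noncomputable def controlOpO (φ : SchurClass U Y) (β : RHP) :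
    U →L[ℂ] RiggedSpace (mainOpO φ) β :=
  ((riggedEquivO φ β).symm : Ho φ →L[ℂ] RiggedSpace (mainOpO φ) β) ∘L schurQuotO φ β

theorem riggedEquivO_controlOpO (φ : SchurClass U Y) (β : RHP) (u : U) :
    riggedEquivO φ β (controlOpO φ β u) = schurQuotO φ β u :=
  (riggedEquivO φ β).apply_symm_apply _

/-- After the unitary and multiplication by `β - μ`, the claim is the difference of the model's
functional equations at `μ` and `β`, in which the output constant cancels. -/
theorem isControlOperator_controlOpO (φ : SchurClass U Y) (β : RHP) :
    IsControlOperator (observableModel φ) β (riggedMainOpO φ β) (controlOpO φ β) := by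
  intro w
  refine (riggedEquivO φ β).injective ?_
  refine (riggedEquivO_riggedIncl φ β _).trans ?_
  rw [map_add, riggedEquivO_riggedMainOpO, riggedEquivO_controlOpO]
  refine Ho.ext_of_ne β fun μ hμ => smul_right_injective Y (RHP.sub_ne_zero_of_ne hμ) ?_
  have h1 := smul_diffQuotO_apply φ β (observableModel φ w).fst μ
  have h2 := smul_diffQuotO_apply φ β (w : WithLp 2 (Ho φ × U)).fst μ
  have h3 := smul_schurQuotO_apply φ β (w : WithLp 2 (Ho φ × U)).snd μ
  have h4 := eq_sub_of_add_eq (observableModel_apply φ w μ)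
  have h5 := eq_sub_of_add_eq (observableModel_apply φ w β)
  simp only [RKHS.coe_add, RKHS.coe_sub, RKHS.coe_smul, Pi.add_apply, Pi.sub_apply, Pi.smul_apply]
  rw [h1, smul_add, smul_sub, smul_comm, h2, h3, h4, h5]
  module

/-- Every input occurs in the domain, which makes the control operator unique. The quotient of `φ u`
at `1` solves the functional equation with output constant `φ(1) u`. -/
theorem exists_mem_domain_observableModel (φ : SchurClass U Y) (u : U) :
    ∃ w : (observableModel φ).domain, (w : WithLp 2 (Ho φ × U)).snd = u := by
  set α : RHP := ⟨1, by simp⟩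
  refine ⟨⟨WithLp.toLp 2 (schurQuotO φ α u, u), (mem_domain_observableModel_iff φ _).mpr
    ⟨(α : ℂ) • schurQuotO φ α u, φ α u, fun μ => ?_⟩⟩, rfl⟩
  have h := smul_schurQuotO_apply φ α u μ
  rw [sub_smul, sub_eq_sub_iff_add_eq_add] at h
  rw [RKHS.coe_smul, Pi.smul_apply]
  change (α : ℂ) • schurQuotO φ α u μ + φ α u = (μ : ℂ) • schurQuotO φ α u μ + φ μ u
  rw [h, add_comm]

theorem isControlOperator_iff (φ : SchurClass U Y) (β : RHP)
    (B : U →L[ℂ] RiggedSpace (mainOpO φ) β) :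
    IsControlOperator (observableModel φ) β (riggedMainOpO φ β) B ↔ B = controlOpO φ β := by
  constructor
  · intro h
    refine ContinuousLinearMap.ext fun u => ?_
    obtain ⟨w, rfl⟩ := exists_mem_domain_observableModel φ u
    exact add_left_cancel ((h w).symm.trans (isControlOperator_controlOpO φ β w))
  · rintro rfl
    exact isControlOperator_controlOpO φ β

theorem riggedEquivO_smul_sub (φ : SchurClass U Y) (α β : RHP) (x : Ho φ) :
    riggedEquivO φ β ((α : ℂ) • riggedIncl (mainOpO φ) β x - riggedMainOpO φ β x)
      = x + ((α : ℂ) - β) • diffQuotO φ β x := by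
  rw [map_sub, map_smul, riggedEquivO_riggedIncl, riggedEquivO_riggedMainOpO]
  module

/-- Under the unitary the map becomes `1 + (α - β)(β - A_o)⁻¹`. By the resolvent identity its
inverse is the same expression with `α` and `β` exchanged. -/
theorem bijective_smul_riggedIncl_sub (φ : SchurClass U Y) (α β : RHP) :
    Function.Bijective
      fun x : Ho φ => (α : ℂ) • riggedIncl (mainOpO φ) β x - riggedMainOpO φ β x := by
  refine (Function.Bijective.of_comp_iff' (riggedEquivO φ β).bijective _).mp ?_
  have e : (riggedEquivO φ β ∘ fun x : Ho φ =>
      (α : ℂ) • riggedIncl (mainOpO φ) β x - riggedMainOpO φ β x)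
      = fun x => x + ((α : ℂ) - β) • diffQuotO φ β x :=
    funext fun x => riggedEquivO_smul_sub φ α β x
  rw [e]
  refine Function.bijective_iff_has_inverse.mpr
    ⟨fun x => x + ((β : ℂ) - α) • diffQuotO φ α x, fun x => ?_, fun x => ?_⟩
  · have h := diffQuotO_sub_diffQuotO φ β α x
    simp only [map_add, map_smul]
    rw [smul_add, smul_comm ((β : ℂ) - α), ← h]
    module
  · have h := diffQuotO_sub_diffQuotO φ α β x
    simp only [map_add, map_smul]
    rw [smul_add, smul_comm ((α : ℂ) - β), ← h]
    module

/-- Under the unitary this relates the quotients of `φ u` at `α` and at `β`; off `μ = β` it reduces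
to arithmetic with the values of `φ u` at `α`, `β` and `μ`. -/
theorem smul_riggedIncl_schurQuotO (φ : SchurClass U Y) (α β : RHP) (u : U) :
    (α : ℂ) • riggedIncl (mainOpO φ) β (schurQuotO φ α u) - riggedMainOpO φ β (schurQuotO φ α u)
      = controlOpO φ β u := by
  refine (riggedEquivO φ β).injective ?_
  rw [riggedEquivO_smul_sub, riggedEquivO_controlOpO]
  refine Ho.ext_of_ne β fun μ hμ => smul_right_injective Y (RHP.sub_ne_zero_of_ne hμ) ?_
  have h1 := smul_diffQuotO_apply φ β (schurQuotO φ α u) μ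
  have h2 := smul_schurQuotO_apply φ α u μ
  have h3 := smul_schurQuotO_apply φ α u β
  have h4 := smul_schurQuotO_apply φ β u μ
  simp only [RKHS.coe_add, RKHS.coe_smul, Pi.add_apply, Pi.smul_apply]
  rw [h4, smul_add, smul_comm, h1, smul_sub, h3]
  have h5 : ((β : ℂ) - μ) • schurQuotO φ α u μ + ((α : ℂ) - β) • schurQuotO φ α u μ
      = φ μ u - φ α u := by rw [← h2]; module
  rw [← add_sub_assoc, h5]
  abel

end DeBrangesRovnyak

/-! ### Assembly of the three assertions -/

theorem theorem5p3 {U Y : Type*}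
    [NormedAddCommGroup U] [InnerProductSpace ℂ U] [CompleteSpace U]
    [NormedAddCommGroup Y] [InnerProductSpace ℂ Y] [CompleteSpace Y]
    (φ : SchurClass U Y) :
    -- the domain of `A_o`
    (∀ x : Ho φ, x ∈ (mainOpO φ).domain ↔
      ∃ y : Y, ∃ z : Ho φ, ∀ μ : RHP, z μ = (μ : ℂ) • x μ - y) ∧
    -- the action of `A_o` and `C_o`
    (∀ x : (mainOpO φ).domain, ∃ L : Y,
      Tendsto (fun η : RHP => (η : ℂ) • (x : Ho φ) η) reAtTop (𝓝 L) ∧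
      (∀ μ : RHP, (mainOpO φ x) μ = (μ : ℂ) • (x : Ho φ) μ - L) ∧
      obsOpO φ x = L) ∧
    -- `A_o` is closed, and its resolvent set contains the right half-plane
    (mainOpO φ).IsClosed ∧
    (∀ α : RHP, (α : ℂ) ∈ resolventSetOp (mainOpO φ)) ∧
    -- the resolvent of `A_o`, and its products with `A_o` and `C_o`
    (∀ (α : RHP) (x : Ho φ),
      IsDiffQuot (fun μ : RHP => x μ) α
        (fun μ : RHP => (resolventOp (mainOpO φ) α x : Ho φ) μ) ∧
      IsDiffQuot (fun μ : RHP => (μ : ℂ) • x μ) α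
        (fun μ : RHP => (mainOpO φ (resolventOp (mainOpO φ) α x)) μ) ∧
      obsOpO φ (resolventOp (mainOpO φ) α x) = x α) ∧
    -- for every rigging parameter `β`, the extension `T = A_o|` and the control operator `B = B_o`
    -- exist and are unique, and `(α - A_o|)⁻¹ B_o` is given by the difference quotient of `φ`
    (∀ β : RHP, ∃ T : Ho φ →L[ℂ] RiggedSpace (mainOpO φ) β,
      (∀ T' : Ho φ →L[ℂ] RiggedSpace (mainOpO φ) β,
        IsRiggedExtension (mainOpO φ) β T' ↔ T' = T) ∧
      ∃ B : U →L[ℂ] RiggedSpace (mainOpO φ) β,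
        (∀ B' : U →L[ℂ] RiggedSpace (mainOpO φ) β,
          IsControlOperator (observableModel φ) β T B' ↔ B' = B) ∧
        ∀ α : RHP,
          Function.Bijective
            (fun x : Ho φ => (α : ℂ) • riggedIncl (mainOpO φ) β x - T x) ∧
          ∀ u : U, ∃ g : Ho φ,
            (α : ℂ) • riggedIncl (mainOpO φ) β g - T g = B u ∧
            IsDiffQuot (fun μ : RHP => φ μ u) α (fun μ : RHP => g μ)) := by
  refine ⟨mem_domain_mainOpO_iff φ, fun x => ⟨obsOpO φ x, tendsto_smul_apply_reAtTop φ x,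
    mainOpO_apply φ x, rfl⟩, isClosed_mainOpO φ, bijective_shiftOp_mainOpO φ, fun α x => ?_,
    fun β => ⟨riggedMainOpO φ β, isRiggedExtension_iff φ β, controlOpO φ β,
      isControlOperator_iff φ β, fun α => ⟨bijective_smul_riggedIncl_sub φ α β, fun u =>
        ⟨schurQuotO φ α u, smul_riggedIncl_schurQuotO φ α β u,
          Ho.isDiffQuot (smul_schurQuotO_apply φ α u)⟩⟩⟩⟩
  rw [resolventOp_mainOpO]
  refine ⟨Ho.isDiffQuot (smul_diffQuotO_apply φ α x), ?_, (mainOpO_diffQuotO φ α x).2⟩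
  -- With `R` the resolvent at `α`, `A_o R x = α R x - x`; multiplication by `α - μ` gives `μ x(μ) -
  -- α x(α)`.
  rw [(mainOpO_diffQuotO φ α x).1]
  refine Ho.isDiffQuot fun μ => ?_
  have h := smul_diffQuotO_apply φ α x μ
  simp only [RKHS.coe_sub, RKHS.coe_smul, Pi.sub_apply, Pi.smul_apply]
  rw [smul_sub, smul_comm, h]
  module
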